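/- Let $l^2$ be the complex Hilbert space of square-summable sequences $\mathbf a=(a_n)_{n\in\mathbb Z}$ with inner product $\langle \mathbf a,\mathbf b\rangle=\sum_n a_n\overline{b_n}$. Let $\widetilde H$ be the discrete Hilbert transform, $(\widetilde H\mathbf a)_m=\frac1\pi\sum_{n\ne m}\frac{a_n}{m-n}$, which is a bounded operator on $l^2$, and let $H=\pi\widetilde H$ and $e^{tH}=\sum_{k\ge 0}\frac{t^k}{k!}H^k$. For $\mathbf a,\mathbf a^*\in l^2$ define $\Psi:\mathbb R\to\mathbb C$ by $$\Psi(t)=\Big\langle \frac{e^{tH}\mathbf a-\mathbf a}{t},\mathbf a^*\Big\rangle\quad(t\neq 0),\qquad \Psi(0)=\langle H\mathbf a,\mathbf a^*\rangle .$$ Let $(t_k)_{k\in\mathbb Z}$ be real numbers with $\sup_{k\in\mathbb Z}|t_k-k|<\tfrac14$, and let $$G(z)=(z-t_0)\prod_{k=1}^\infty\Big(1-\frac{z}{t_k}\Big)\Big(1-\frac{z}{t_{-k}}\Big),\qquad z\in\mathbb C .$$ Then the product converges for every $z\in\mathbb C$, $G$ is an entire function whose zeros are exactly the $t_k$, $k\in\mathbb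 Z$, all of them simple, and $$\Psi(t)=\sum_{k\in\mathbb Z}\Psi(t_k)\,\frac{G(t)}{G'(t_k)(t-t_k)},$$ where the $k$-th quotient is given its limit value $1$ at $t=t_k$, and where the series converges (unconditionally, i.e. along the net of finite subsets of $\mathbb Z$) uniformly on every compact subset of $\mathbb R$. -/

import Mathlib

open scoped ENNReal

noncomputable section

namespace DiscreteHilbert

/-- The complex Hilbert space `l²` of square-summable sequences indexed by `ℤ`. -/
abbrev L2Z : Type := lp (fun _ : ℤ => ℂ) 2

/-- The entry `b_m = (1/π) ∑_{n ≠ m} a_n / (m - n)` of the discrete Hilbert transform of `a`. -/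
def hilbertEntry (a : ℤ → ℂ) (m : ℤ) : ℂ :=
  (1 / (Real.pi : ℂ)) * ∑' n : ℤ, if n = m then 0 else a n / ((m : ℂ) - (n : ℂ))

section Boundedness

/- The discrete Hilbert transform is well defined and bounded on `l²`: on the Fourier side it is
multiplication by a bounded sawtooth function. -/

open MeasureTheory AddCircle

/-- The sawtooth function whose Fourier coefficients are `1 / (π n)` for `n ≠ 0`, and `0` at `0`. -/
def sawtooth (x : UnitAddCircle) : ℂ :=
  (-(2 * Complex.I)) * (periodizedBernoulli 1 x : ℂ)

lemma fourierCoeff_sawtooth (n : ℤ) :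
    fourierCoeff sawtooth n = (1 / (Real.pi : ℂ)) * (1 / (n : ℂ)) := by
  have h := fourierCoeff_bernoulli_eq (k := 1) one_ne_zero n
  have h2 := fourierCoeff.const_mul (T := 1)
    ((fun x : ℝ => (x : ℂ)) ∘ periodizedBernoulli 1) (-(2 * Complex.I)) n
  have h3 : fourierCoeff sawtooth n = (-(2 * Complex.I)) *
      (-(Nat.factorial 1 : ℕ) / (2 * Real.pi * Complex.I * n) ^ 1) := by
    rw [← h]; exact h2
  rw [h3]
  have hpi : (Real.pi : ℂ) ≠ 0 := by exact_mod_cast Real.pi_ne_zero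
  by_cases hn : (n : ℂ) = 0
  · simp [hn]
  · have hI := Complex.I_ne_zero
    simp only [Nat.factorial_one, Nat.cast_one, pow_one]
    field_simp

lemma measurable_sawtooth : Measurable sawtooth := by
  have h1 : Measurable (periodizedBernoulli 1) := by
    have : Measurable (bernoulliFun 1) := (Polynomial.continuous _).measurable
    exact (this.comp measurable_subtype_coe).comp (AddCircle.measurableEquivIco 1 0).measurable
  exact (Complex.measurable_ofReal.comp h1).const_mul _

lemma norm_sawtooth_le (x : UnitAddCircle) : ‖sawtooth x‖ ≤ 1 := by
  have hx := (AddCircle.equivIco (1 : ℝ) 0 x).2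
  have h : periodizedBernoulli 1 x = (AddCircle.equivIco (1 : ℝ) 0 x : ℝ) - 1 / 2 := by
    change bernoulliFun 1 _ = _
    simp [bernoulliFun, Polynomial.bernoulli_one]
  have h2 : |periodizedBernoulli 1 x| ≤ 1 / 2 := by
    rw [h, abs_le]
    have := hx.1
    have := hx.2
    constructor <;> linarith
  rw [sawtooth, norm_mul, Complex.norm_real, Real.norm_eq_abs]
  simp only [norm_neg, norm_mul, Complex.norm_I, Complex.norm_ofNat]
  linarith

lemma memLp_sawtooth : MemLp sawtooth ∞ (haarAddCircle (T := 1)) :=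
  memLp_top_of_bound measurable_sawtooth.aestronglyMeasurable 1
    (Filter.Eventually.of_forall norm_sawtooth_le)

/-- The discrete Hilbert transform as a Fourier multiplier; only used to prove boundedness. -/
def multiplier : L2Z →L[ℂ] L2Z :=
  ((fourierBasis (T := 1)).repr.toContinuousLinearEquiv : _ →L[ℂ] L2Z) ∘L
    ((ContinuousLinearMap.mul ℂ ℂ).holderL (haarAddCircle (T := 1)) ∞ 2 2
      (memLp_sawtooth.toLp sawtooth)) ∘L
    ((fourierBasis (T := 1)).repr.symm.toContinuousLinearEquiv : L2Z →L[ℂ] _)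

lemma multiplier_single (n m : ℤ) (c : ℂ) :
    multiplier (lp.single 2 n c) m =
      (1 / (Real.pi : ℂ)) * (if n = m then 0 else c / ((m : ℂ) - (n : ℂ))) := by
  have e : lp.single 2 n c = c • (lp.single 2 n (1 : ℂ) : L2Z) := by
    rw [← lp.single_smul]; simp
  have key : multiplier (lp.single 2 n (1 : ℂ)) m = fourierCoeff sawtooth (m - n) := by
    have e1 : multiplier (lp.single 2 n (1 : ℂ)) = (fourierBasis (T := 1)).repr
        ((ContinuousLinearMap.mul ℂ ℂ).holder 2 (memLp_sawtooth.toLp sawtooth)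
          ((fourierBasis (T := 1)).repr.symm (lp.single 2 n (1 : ℂ)))) := rfl
    rw [e1, fourierBasis_repr, HilbertBasis.repr_symm_single, coe_fourierBasis]
    unfold fourierCoeff
    refine integral_congr_ae ?_
    filter_upwards [(ContinuousLinearMap.mul ℂ ℂ).coeFn_holder (r := 2)
      (memLp_sawtooth.toLp sawtooth) (fourierLp (T := 1) 2 n),
      memLp_sawtooth.coeFn_toLp, coeFn_fourierLp (T := 1) 2 n] with x h1 h2 h3
    rw [h1, h2, h3]
    rw [show -(m - n) = -m + n by ring, fourier_add]
    simp only [ContinuousLinearMap.mul_apply', smul_eq_mul]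
    ring
  rw [e, map_smul, lp.coeFn_smul, Pi.smul_apply, key, fourierCoeff_sawtooth]
  by_cases h : n = m
  · simp [h]
  · rw [if_neg h]; push_cast; simp only [smul_eq_mul]; ring

lemma hasSum_multiplier (a : L2Z) (m : ℤ) :
    HasSum (fun n : ℤ => (1 / (Real.pi : ℂ)) * (if n = m then 0 else a n / ((m : ℂ) - (n : ℂ))))
      (multiplier a m) := by
  have h := lp.hasSum_single (p := 2) (by simp) a
  have h2 := h.mapL (((lp.evalCLM ℂ (fun _ : ℤ => ℂ) 2 m)) ∘L multiplier)
  convert! h2 using 2 with n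
  exact (multiplier_single n m (a n)).symm

end Boundedness

lemma multiplier_apply (a : L2Z) (m : ℤ) : multiplier a m = hilbertEntry a m := by
  rw [hilbertEntry, ← tsum_mul_left, (hasSum_multiplier a m).tsum_eq]

/-- The discrete Hilbert transform `b_m = (1/π) ∑_{n ≠ m} a_n / (m - n)` as a bounded operator
on `l²`. -/
def discreteHilbertTransform : L2Z →L[ℂ] L2Z where
  toFun a := ⟨hilbertEntry a, by
    have h : hilbertEntry a = (multiplier a : ℤ → ℂ) := by
      ext m; exact (multiplier_apply a m).symm
    rw [h]; exact lp.memℓp (multiplier a)⟩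
  map_add' a b := by
    ext m
    change hilbertEntry (a + b : L2Z) m = hilbertEntry a m + hilbertEntry b m
    rw [← multiplier_apply, ← multiplier_apply, ← multiplier_apply, map_add]
    rfl
  map_smul' c a := by
    ext m
    change hilbertEntry (c • a : L2Z) m = c * hilbertEntry a m
    rw [← multiplier_apply, ← multiplier_apply, map_smul]
    rfl
  cont := by
    refine multiplier.continuous.congr fun a => ?_
    ext m
    exact multiplier_apply a m

/-- The operator `H = π H̃`. -/
def H : L2Z →L[ℂ] L2Z := (Real.pi : ℂ) • discreteHilbertTransform

/-- The inner product `⟨x, y⟩ = ∑ x_n conj(y_n)`, linear in the first variable. -/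
def pairing (x y : L2Z) : ℂ := inner ℂ y x

/-- `Ψ(t) = ⟨(e^{tH} a - a) / t, a*⟩` for `t ≠ 0`, and `Ψ(0) = ⟨H a, a*⟩`. -/
def Psi (a aStar : L2Z) (t : ℝ) : ℂ :=
  if t = 0 then pairing (H a) aStar
  else pairing ((t : ℂ)⁻¹ • (NormedSpace.exp ((t : ℂ) • H) a - a)) aStar

/-- The `k`-th factor, `k ≥ 1`, of the canonical product. -/
def pairFactor (τ : ℤ → ℝ) (k : ℕ) (z : ℂ) : ℂ :=
  (1 - z / (τ (k : ℤ) : ℂ)) * (1 - z / (τ (-(k : ℤ)) : ℂ))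

/-- `G(z) = (z - t_0) ∏_{k ≥ 1} (1 - z / t_k) (1 - z / t_{-k})`. -/
def G (τ : ℤ → ℝ) (z : ℂ) : ℂ :=
  (z - (τ 0 : ℂ)) * ∏' k : ℕ, pairFactor τ (k + 1) z

/-- The sampling function `G(t) / (G'(t_k) (t - t_k))`, with its limit `1` at `t = t_k`. -/
def samplingKernel (τ : ℤ → ℝ) (k : ℤ) (t : ℝ) : ℂ :=
  if t = τ k then 1
  else G τ (t : ℂ) / (deriv (G τ) (τ k : ℂ) * ((t : ℂ) - (τ k : ℂ)))

end DiscreteHilbert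

end

/-! On the Fourier side `H` is multiplication by `-2πi c(x)`, with `c` the centred fractional part,
so `e^{tH}` is multiplication by `e_t = exp(-2πi t c)`. Since `(e_t - 1)/t = -2πi ∫_0^c exp(-2πi t
u) du`, Fubini gives `Ψ(t) = φ(e_t)` for a bounded functional `φ` on `L²` of the circle
(`exists_functional_Psi`). By Kadec's 1/4-theorem there is an isomorphism `T` from `l²` onto `L²`
with `T δ_k = e_{t_k}` (`exists_riesz_equiv`). Expanding `e_t` in this Riesz basis and applying `φ`
gives `Ψ(t) = ∑ (T⁻¹ e_t)_k Ψ(t_k)`. The convergence is uniform on compact sets because `t ↦ T⁻¹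
e_t` is continuous and coordinate truncations are contractions tending strongly to the identity.

It remains to identify `(T⁻¹ e_t)_k` with `G(t) / (G'(t_k)(t - t_k))`. If the nodes outside `[-N,
N]` are replaced by integers, the coordinates become explicit by Lagrange interpolation: up to a
constant, they are `sin πt ∏_{j≠k} (t - t_j) / ∏ (t - j)`. As `N → ∞` these coordinates converge to
those of `T`, and Euler's product for the sine leaves `G(t)/(t - t_k)` up to a constant
(`G_mul_coord_comm`). The value `1` at `t_k` fixes the constant and also shows that `G'(t_k) ≠ 0`
(`deriv_G_ne_zero_and_coord_eq`). -/

noncomputable section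

namespace DiscreteHilbert

/-! ### Exponentials of real frequency on the circle and the integer orthonormal basis. -/

section ExponentialSystem

open MeasureTheory AddCircle

/-- The Hilbert space of square-integrable functions on the circle. -/
abbrev L2Circle : Type := Lp ℂ 2 (haarAddCircle (T := 1))

/-- Multiplication by an essentially bounded function. -/
def mulOp {m : UnitAddCircle → ℂ} (hm : MemLp m ∞ (haarAddCircle (T := 1))) :
    L2Circle →L[ℂ] L2Circle :=
  (ContinuousLinearMap.mul ℂ ℂ).holderL (haarAddCircle (T := 1)) ∞ 2 2 (hm.toLp m)

lemma coeFn_mulOp {m : UnitAddCircle → ℂ} (hm : MemLp m ∞ (haarAddCircle (T := 1)))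
    (f : L2Circle) : mulOp hm f =ᵐ[haarAddCircle] fun x => m x * f x := by
  filter_upwards [(ContinuousLinearMap.mul ℂ ℂ).coeFn_holder (r := 2) (hm.toLp m) f,
    hm.coeFn_toLp] with x h1 h2
  change ((ContinuousLinearMap.mul ℂ ℂ).holder 2 (hm.toLp m) f : UnitAddCircle → ℂ) x = _
  rw [h1, h2]
  simp

lemma norm_mulOp_le {m : UnitAddCircle → ℂ} (hm : MemLp m ∞ (haarAddCircle (T := 1)))
    (hb : ∀ x, ‖m x‖ ≤ 1) : ‖mulOp hm‖ ≤ 1 := by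
  refine ContinuousLinearMap.opNorm_le_bound _ zero_le_one fun f => ?_
  rw [one_mul]
  refine Lp.norm_le_norm_of_ae_le ?_
  filter_upwards [coeFn_mulOp hm f] with x hx
  rw [hx, norm_mul]
  exact mul_le_of_le_one_left (norm_nonneg _) (hb x)

/-- The centred fractional part, with values in `[-1/2, 1/2)`. -/
def centre (x : UnitAddCircle) : ℝ := periodizedBernoulli 1 x

lemma centre_eq (x : UnitAddCircle) :
    centre x = (AddCircle.equivIco (1 : ℝ) 0 x : ℝ) - 1 / 2 := by
  change bernoulliFun 1 _ = _
  simp [bernoulliFun, Polynomial.bernoulli_one]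

lemma centre_coe {x : ℝ} (hx : x ∈ Set.Ico (0 : ℝ) 1) :
    centre (x : UnitAddCircle) = x - 1 / 2 := by
  rw [centre_eq, AddCircle.coe_equivIco_mk_apply]
  simp only [sub_left_inj, div_one, mul_one]
  exact Int.fract_eq_self.2 hx

lemma centre_mem (x : UnitAddCircle) : centre x ∈ Set.Ico (-(1 / 2) : ℝ) (1 / 2) := by
  have hx := (AddCircle.equivIco (1 : ℝ) 0 x).2
  have h1 := hx.1
  have h2 := hx.2
  rw [centre_eq]
  constructor <;> linarith

lemma abs_centre_le (x : UnitAddCircle) : |centre x| ≤ 1 / 2 :=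
  abs_le.2 ⟨(centre_mem x).1, (centre_mem x).2.le⟩

lemma measurable_centre : Measurable centre := by
  have : Measurable (bernoulliFun 1) := (Polynomial.continuous _).measurable
  exact (this.comp measurable_subtype_coe).comp (AddCircle.measurableEquivIco 1 0).measurable

lemma integral_comp_centre (f : ℝ → ℂ) :
    ∫ x : UnitAddCircle, f (centre x) ∂haarAddCircle = ∫ u in (-(1 / 2) : ℝ)..(1 / 2), f u := by
  rw [integral_haarAddCircle, inv_one, one_smul,
    ← AddCircle.intervalIntegral_preimage 1 0 (fun x => f (centre x)), zero_add]
  have h : ∫ a in (0 : ℝ)..1, f (centre (a : UnitAddCircle)) =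
      ∫ a in (0 : ℝ)..1, f (a - 1 / 2) := by
    refine intervalIntegral.integral_congr_ae ?_
    -- The endpoint `1` is the circle point `0`, where the centred part is `-1/2` and not `1/2`.
    have h1 : ∀ᵐ a : ℝ, a ≠ 1 := by simp [ae_iff]
    filter_upwards [h1] with a ha hmem
    rw [Set.uIoc_of_le zero_le_one] at hmem
    rw [centre_coe ⟨hmem.1.le, lt_of_le_of_ne hmem.2 ha⟩]
  rw [h, intervalIntegral.integral_comp_sub_right]
  norm_num

/-- The exponential `x ↦ exp (-2πi t x)`, with `x` ranging in `[-1/2, 1/2)`. -/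
def expFun (t : ℝ) (x : UnitAddCircle) : ℂ :=
  Complex.exp ((-(2 * Real.pi * t * centre x) : ℝ) * Complex.I)

lemma norm_expFun (t : ℝ) (x : UnitAddCircle) : ‖expFun t x‖ = 1 :=
  Complex.norm_exp_ofReal_mul_I _

lemma measurable_expFun (t : ℝ) : Measurable (expFun t) := by
  unfold expFun
  have := measurable_centre
  fun_prop

lemma expFun_add (s t : ℝ) (x : UnitAddCircle) : expFun (s + t) x = expFun s x * expFun t x := by
  rw [expFun, expFun, expFun, ← Complex.exp_add]
  congr 1
  push_cast
  ring

lemma conj_expFun (t : ℝ) (x : UnitAddCircle) :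
    (starRingEnd ℂ) (expFun t x) = expFun (-t) x := by
  rw [expFun, expFun, ← Complex.exp_conj]
  congr 1
  rw [map_mul, Complex.conj_ofReal, Complex.conj_I]
  push_cast
  ring

lemma memLp_expFun (p : ℝ≥0∞) (t : ℝ) : MemLp (expFun t) p (haarAddCircle (T := 1)) :=
  MemLp.of_bound (measurable_expFun t).aestronglyMeasurable 1
    (Filter.Eventually.of_forall fun x => (norm_expFun t x).le)

/-- The exponential `expFun t` as a vector of `L²`. -/
def expVec (t : ℝ) : L2Circle := (memLp_expFun 2 t).toLp (expFun t)

lemma coeFn_expVec (t : ℝ) : expVec t =ᵐ[haarAddCircle] expFun t := (memLp_expFun 2 t).coeFn_toLp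

/-- Multiplication by the exponential `expFun s`. -/
def modulation (s : ℝ) : L2Circle →L[ℂ] L2Circle := mulOp (memLp_expFun ∞ s)

lemma norm_modulation_le (s : ℝ) : ‖modulation s‖ ≤ 1 :=
  norm_mulOp_le _ fun x => (norm_expFun s x).le

lemma modulation_expVec (s t : ℝ) : modulation s (expVec t) = expVec (s + t) := by
  refine Lp.ext ?_
  filter_upwards [coeFn_mulOp (memLp_expFun ∞ s) (expVec t), coeFn_expVec t,
    coeFn_expVec (s + t)] with x h1 h2 h3
  rw [h3, expFun_add, ← h2]
  exact h1

lemma integral_expFun (t : ℝ) :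
    ∫ x : UnitAddCircle, expFun t x ∂haarAddCircle = (Real.sinc (Real.pi * t) : ℂ) := by
  have h := integral_comp_centre
    (fun u => Complex.exp ((-(2 * Real.pi * t * u) : ℝ) * Complex.I))
  unfold expFun
  rw [h]
  rcases eq_or_ne t 0 with rfl | ht
  · simp; norm_num
  have hc : (-(2 * Real.pi * t) * Complex.I : ℂ) ≠ 0 := by
    simp [Real.pi_ne_zero, ht]
  have e : ∀ u : ℝ, ((-(2 * Real.pi * t * u) : ℝ) * Complex.I : ℂ) =
      (-(2 * Real.pi * t) * Complex.I : ℂ) * u := fun u => by push_cast; ring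
  simp_rw [e]
  rw [integral_exp_mul_complex hc, Real.sinc_of_ne_zero (mul_ne_zero Real.pi_ne_zero ht)]
  have hs := Complex.two_sin (Real.pi * t)
  have e1 : (-(2 * Real.pi * t) * Complex.I : ℂ) * ((1 / 2 : ℝ) : ℂ) =
      -(Real.pi * t) * Complex.I := by push_cast; ring
  have e2 : (-(2 * Real.pi * t) * Complex.I : ℂ) * ((-(1 / 2) : ℝ) : ℂ) =
      Real.pi * t * Complex.I := by push_cast; ring
  have hs' : (Real.sin (Real.pi * t) : ℂ) = (Complex.exp (-(Real.pi * t) * Complex.I) -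
      Complex.exp (Real.pi * t * Complex.I)) * Complex.I / 2 := by
    rw [← hs]; push_cast; ring
  rw [e1, e2, Complex.ofReal_div, hs']
  have hpi : (Real.pi : ℂ) ≠ 0 := by exact_mod_cast Real.pi_ne_zero
  have ht' : (t : ℂ) ≠ 0 := by exact_mod_cast ht
  push_cast
  have hI := Complex.I_ne_zero
  have hII := Complex.I_sq
  field_simp
  rw [hII]
  ring

lemma inner_expVec (s t : ℝ) :
    inner ℂ (expVec s) (expVec t) = (Real.sinc (Real.pi * (t - s)) : ℂ) := by
  rw [L2.inner_def, ← integral_expFun]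
  refine integral_congr_ae ?_
  filter_upwards [coeFn_expVec s, coeFn_expVec t] with x h1 h2
  rw [h1, h2, sub_eq_neg_add, expFun_add, ← conj_expFun]
  simp [mul_comm]

lemma norm_expVec_sub_le (s t : ℝ) : ‖expVec s - expVec t‖ ≤ Real.pi * |s - t| := by
  have h := Lp.norm_le_of_ae_bound (f := expVec s - expVec t) (C := Real.pi * |s - t|)
    (mul_nonneg Real.pi_pos.le (abs_nonneg _)) ?_
  · refine h.trans (le_of_eq ?_)
    have h1 : measureUnivNNReal (haarAddCircle (T := 1)) = 1 := by simp [measureUnivNNReal]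
    rw [h1]
    simp
  filter_upwards [Lp.coeFn_sub (expVec s) (expVec t), coeFn_expVec s, coeFn_expVec t]
    with x h0 h1 h2
  rw [h0, Pi.sub_apply, h1, h2, expFun, expFun]
  have h3 : ∀ a b : ℝ, ‖Complex.exp (a * Complex.I) - Complex.exp (b * Complex.I)‖ ≤ |a - b| := by
    intro a b
    have e : Complex.exp (a * Complex.I) - Complex.exp (b * Complex.I) =
        Complex.exp (b * Complex.I) * (Complex.exp (Complex.I * ((a - b : ℝ) : ℂ)) - 1) := by
      rw [mul_sub, ← Complex.exp_add, mul_one]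
      congr 2
      push_cast; ring
    rw [e, norm_mul, Complex.norm_exp_ofReal_mul_I, one_mul]
    exact Real.norm_exp_I_mul_ofReal_sub_one_le
  refine (h3 _ _).trans ?_
  have e : -(2 * Real.pi * s * centre x) - -(2 * Real.pi * t * centre x) =
      -(2 * centre x) * (Real.pi * (s - t)) := by ring
  rw [e, abs_mul, abs_mul, abs_of_pos Real.pi_pos, abs_neg, abs_mul, abs_two]
  have := abs_centre_le x
  refine mul_le_of_le_one_left (mul_nonneg Real.pi_pos.le (abs_nonneg _)) (by linarith)

lemma continuous_expVec : Continuous expVec := by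
  have : LipschitzWith ⟨Real.pi, Real.pi_pos.le⟩ expVec :=
    LipschitzWith.of_dist_le_mul fun s t => by
      rw [dist_eq_norm, Real.dist_eq]; exact norm_expVec_sub_le s t
  exact this.continuous

lemma sinc_pi_mul_int (n : ℤ) : Real.sinc (Real.pi * n) = if n = 0 then 1 else 0 := by
  split_ifs with h
  · simp [h]
  · rw [Real.sinc_of_ne_zero (mul_ne_zero Real.pi_ne_zero (by exact_mod_cast h)), mul_comm,
      Real.sin_int_mul_pi, zero_div]

lemma orthonormal_expVec : Orthonormal ℂ fun k : ℤ => expVec k := by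
  rw [orthonormal_iff_ite]
  intro i j
  rw [inner_expVec, ← Int.cast_sub, sinc_pi_mul_int]
  simp only [sub_eq_zero, eq_comm]
  split_ifs <;> simp

/-- The sign comes from the shift by `1/2` in the centring, the minus in `-k` from the sign
convention of the exponent. -/
lemma expFun_int (k : ℤ) (x : UnitAddCircle) :
    expFun k x = (-1) ^ k * fourier (-k) x := by
  obtain ⟨y, hy, rfl⟩ : ∃ y : ℝ, y ∈ Set.Ico (0 : ℝ) 1 ∧ (y : UnitAddCircle) = x := by
    refine ⟨AddCircle.equivIco (1 : ℝ) 0 x, ?_, AddCircle.coe_equivIco⟩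
    have := (AddCircle.equivIco (1 : ℝ) 0 x).2
    simpa using this
  rw [fourier_coe_apply, expFun, centre_coe hy, ← Complex.exp_pi_mul_I, ← Complex.exp_int_mul,
    ← Complex.exp_add]
  congr 1
  push_cast
  ring

lemma expVec_int (k : ℤ) : expVec k = (-1 : ℂ) ^ k • (fourierLp (T := 1) 2 (-k) : L2Circle) := by
  refine Lp.ext ?_
  filter_upwards [coeFn_expVec k, coeFn_fourierLp (T := 1) 2 (-k),
    Lp.coeFn_smul ((-1 : ℂ) ^ k) (fourierLp (T := 1) 2 (-k))] with x h1 h2 h3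
  rw [h1, h3, Pi.smul_apply, h2, expFun_int, smul_eq_mul]

/-- The orthonormal basis of integer exponentials. -/
def expBasis : HilbertBasis ℤ ℂ L2Circle :=
  HilbertBasis.mk orthonormal_expVec (by
    rw [← span_fourierLp_closure_eq_top (T := 1) (p := 2) (by simp)]
    refine Submodule.topologicalClosure_mono (Submodule.span_le.2 ?_)
    rintro _ ⟨n, rfl⟩
    have h := expVec_int (-n)
    rw [neg_neg] at h
    have h2 : (fourierLp (T := 1) 2 n : L2Circle) = ((-1 : ℂ) ^ (-n))⁻¹ • expVec ((-n : ℤ) : ℝ) := by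
      rw [h, smul_smul, inv_mul_cancel₀ (zpow_ne_zero _ (by norm_num)), one_smul]
    rw [h2]
    exact Submodule.smul_mem _ _ (Submodule.subset_span ⟨-n, rfl⟩))

lemma expBasis_apply (k : ℤ) : expBasis k = expVec k := by
  rw [expBasis, HilbertBasis.coe_mk]

end ExponentialSystem

/-! ### `Ψ` as a bounded functional evaluated on exponentials. -/

section Psi

open MeasureTheory AddCircle

/-- The symbol of `H`. -/
def symbol (x : UnitAddCircle) : ℂ := -(2 * Real.pi * Complex.I) * (centre x : ℂ)

lemma norm_symbol_le (x : UnitAddCircle) : ‖symbol x‖ ≤ Real.pi := by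
  rw [symbol, norm_mul, norm_neg, norm_mul, norm_mul, Complex.norm_I, Complex.norm_real,
    Complex.norm_real, Complex.norm_ofNat, Real.norm_of_nonneg Real.pi_pos.le, Real.norm_eq_abs]
  have := abs_centre_le x
  nlinarith [Real.pi_pos]

lemma measurable_symbol : Measurable symbol := by
  unfold symbol
  have := measurable_centre
  fun_prop

lemma memLp_symbol : MemLp symbol ∞ (haarAddCircle (T := 1)) :=
  memLp_top_of_bound measurable_symbol.aestronglyMeasurable Real.pi
    (Filter.Eventually.of_forall norm_symbol_le)

lemma H_apply (a : L2Z) : H a =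
    (fourierBasis (T := 1)).repr (mulOp memLp_symbol ((fourierBasis (T := 1)).repr.symm a)) := by
  have h1 : discreteHilbertTransform a = multiplier a := by
    ext m
    exact (multiplier_apply a m).symm
  have h2 : multiplier a = (fourierBasis (T := 1)).repr
      (mulOp memLp_sawtooth ((fourierBasis (T := 1)).repr.symm a)) := rfl
  rw [H, smul_apply, h1, h2, ← map_smul]
  congr 1
  refine Lp.ext ?_
  filter_upwards [Lp.coeFn_smul (Real.pi : ℂ)
    (mulOp memLp_sawtooth ((fourierBasis (T := 1)).repr.symm a)),
    coeFn_mulOp memLp_sawtooth ((fourierBasis (T := 1)).repr.symm a),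
    coeFn_mulOp memLp_symbol ((fourierBasis (T := 1)).repr.symm a)] with x h3 h4 h5
  rw [h3, Pi.smul_apply, h4, h5, sawtooth, symbol, centre, smul_eq_mul]
  ring

lemma H_pow_apply (n : ℕ) (a : L2Z) : (H ^ n) a = (fourierBasis (T := 1)).repr
    ((mulOp memLp_symbol ^ n) ((fourierBasis (T := 1)).repr.symm a)) := by
  induction n with
  | zero => simp
  | succ n ih =>
    rw [pow_succ', pow_succ', mul_apply_eq_comp, ih, H_apply]
    simp

lemma coeFn_mulOp_pow {m : UnitAddCircle → ℂ} (hm : MemLp m ∞ (haarAddCircle (T := 1)))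
    (n : ℕ) (f : L2Circle) : (mulOp hm ^ n) f =ᵐ[haarAddCircle] fun x => m x ^ n * f x := by
  induction n with
  | zero => simp
  | succ n ih =>
    rw [pow_succ', mul_apply_eq_comp]
    filter_upwards [ih, coeFn_mulOp hm ((mulOp hm ^ n) f)] with x h1 h2
    rw [h2, h1, pow_succ']
    ring

/-- The product of the Fourier series of `a` with the conjugate of that of `b`. -/
def density (a b : L2Z) (x : UnitAddCircle) : ℂ :=
  inner ℂ ((fourierBasis (T := 1)).repr.symm b x) ((fourierBasis (T := 1)).repr.symm a x)

lemma integrable_density (a b : L2Z) : Integrable (density a b) (haarAddCircle (T := 1)) :=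
  L2.integrable_inner _ _

lemma pairing_H_pow (a b : L2Z) (n : ℕ) :
    pairing ((H ^ n) a) b = ∫ x, symbol x ^ n * density a b x ∂haarAddCircle := by
  rw [pairing, H_pow_apply, ← (fourierBasis (T := 1)).repr.symm.inner_map_map,
    LinearIsometryEquiv.symm_apply_apply, L2.inner_def]
  refine integral_congr_ae ?_
  filter_upwards [coeFn_mulOp_pow memLp_symbol n ((fourierBasis (T := 1)).repr.symm a)] with x hx
  rw [hx, density, ← smul_eq_mul (symbol x ^ n), inner_smul_right]

lemma pairing_exp_H (a b : L2Z) (t : ℝ) :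
    pairing (NormedSpace.exp ((t : ℂ) • H) a) b =
      ∫ x, Complex.exp (t * symbol x) * density a b x ∂haarAddCircle := by
  have h1 := NormedSpace.exp_series_hasSum_exp' (𝕂 := ℂ) ((t : ℂ) • H)
  have h2 := h1.mapL ((innerSL ℂ b) ∘L (ContinuousLinearMap.apply ℂ L2Z a))
  have h3 : HasSum (fun n : ℕ => ∫ x, ((n.factorial : ℂ)⁻¹ * (t * symbol x) ^ n) * density a b x
      ∂haarAddCircle) (∫ x, Complex.exp (t * symbol x) * density a b x ∂haarAddCircle) := by
    have hsum : ∀ x, Summable fun n : ℕ =>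
        ((n.factorial : ℝ)⁻¹ * (|t| * Real.pi) ^ n) * ‖density a b x‖ := fun x => by
      refine Summable.mul_right _ ?_
      simpa [div_eq_inv_mul] using Real.summable_pow_div_factorial (|t| * Real.pi)
    -- The density is only integrable, but the symbol is bounded by `π`, so the exponential series
    -- is dominated by `e^{π|t|}` times its modulus.
    refine hasSum_integral_of_dominated_convergence
      (fun (n : ℕ) x => ((n.factorial : ℝ)⁻¹ * (|t| * Real.pi) ^ n) * ‖density a b x‖)
      ?_ ?_ ?_ ?_ ?_
    · intro n
      have := measurable_symbol
      have h4 : Measurable fun x => ((n.factorial : ℂ)⁻¹ * (t * symbol x) ^ n) := by fun_prop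
      exact h4.aestronglyMeasurable.mul (integrable_density a b).aestronglyMeasurable
    · intro n
      refine Filter.Eventually.of_forall fun x => ?_
      rw [norm_mul, norm_mul, norm_pow, norm_mul, norm_inv, Complex.norm_natCast,
        Complex.norm_real, Real.norm_eq_abs]
      have := norm_symbol_le x
      gcongr
    · exact Filter.Eventually.of_forall hsum
    · simp_rw [tsum_mul_right]
      exact (integrable_density a b).norm.const_mul _
    · refine Filter.Eventually.of_forall fun x => ?_
      have h5 := NormedSpace.exp_series_hasSum_exp' (𝕂 := ℂ) ((t : ℂ) * symbol x)
      rw [← Complex.exp_eq_exp_ℂ] at h5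
      exact h5.mul_right _
  refine (h2.unique ?_)
  convert! h3 using 2 with n
  have h6 : ∀ x, ((n.factorial : ℂ)⁻¹ * (t * symbol x) ^ n) * density a b x =
      ((n.factorial : ℂ)⁻¹ * t ^ n) * (symbol x ^ n * density a b x) := fun x => by
    rw [mul_pow]; ring
  simp_rw [h6]
  rw [integral_const_mul, ← pairing_H_pow, pairing, smul_pow]
  simp [mul_assoc]

lemma exp_mul_symbol (t : ℝ) (x : UnitAddCircle) :
    Complex.exp (t * symbol x) = expFun t x := by
  rw [symbol, expFun]
  congr 1
  push_cast
  ring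

/-- The kernel of the indefinite integral from `0`. -/
def primitiveKernel (x y : ℝ) : ℂ :=
  (if 0 < y ∧ y ≤ x then 1 else 0) - (if x < y ∧ y ≤ 0 then 1 else 0)

lemma norm_primitiveKernel_le (x y : ℝ) : ‖primitiveKernel x y‖ ≤ 2 := by
  unfold primitiveKernel
  refine (norm_sub_le _ _).trans ?_
  split_ifs <;> norm_num

lemma measurable_primitiveKernel : Measurable fun p : ℝ × ℝ => primitiveKernel p.1 p.2 := by
  unfold primitiveKernel
  refine Measurable.sub ?_ ?_
  · refine Measurable.ite (MeasurableSet.inter ?_ ?_) measurable_const measurable_const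
    · exact measurableSet_lt measurable_const measurable_snd
    · exact measurableSet_le measurable_snd measurable_fst
  · refine Measurable.ite (MeasurableSet.inter ?_ ?_) measurable_const measurable_const
    · exact measurableSet_lt measurable_fst measurable_snd
    · exact measurableSet_le measurable_snd measurable_const

lemma integral_primitiveKernel {c : ℝ} (hc : |c| ≤ 1 / 2) {f : ℝ → ℂ} (hf : Continuous f) :
    ∫ u in (-(1 / 2) : ℝ)..(1 / 2), primitiveKernel c u * f u = ∫ u in (0 : ℝ)..c, f u := by
  obtain ⟨hc1, hc2⟩ := abs_le.1 hc
  have e : ∀ u, primitiveKernel c u * f u =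
      (Set.Ioc 0 c).indicator f u - (Set.Ioc c 0).indicator f u := by
    intro u
    simp only [primitiveKernel, Set.indicator, Set.mem_Ioc, sub_mul, ite_mul, one_mul, zero_mul]
  simp_rw [e]
  have hi : ∀ a b : ℝ, Integrable ((Set.Ioc a b).indicator f)
      (volume.restrict (Set.Ioc (-(1 / 2) : ℝ) (1 / 2))) := fun a b =>
    ((hf.integrableOn_Ioc).indicator measurableSet_Ioc)
  rw [intervalIntegral.integral_of_le (by norm_num), integral_sub (hi _ _) (hi _ _),
    intervalIntegral, setIntegral_indicator measurableSet_Ioc,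
    setIntegral_indicator measurableSet_Ioc]
  have h1 : Set.Ioc (-(1 / 2) : ℝ) (1 / 2) ∩ Set.Ioc 0 c = Set.Ioc 0 c :=
    Set.inter_eq_right.2 (Set.Ioc_subset_Ioc (by norm_num) hc2)
  have h2 : Set.Ioc (-(1 / 2) : ℝ) (1 / 2) ∩ Set.Ioc c 0 = Set.Ioc c 0 :=
    Set.inter_eq_right.2 (Set.Ioc_subset_Ioc hc1 (by norm_num))
  rw [h1, h2]

lemma integral_primitiveKernel_expFun (t : ℝ) (x : UnitAddCircle) :
    ∫ y, primitiveKernel (centre x) (centre y) * expFun t y ∂haarAddCircle =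
      ∫ u in (0 : ℝ)..centre x, Complex.exp ((-(2 * Real.pi * t * u) : ℝ) * Complex.I) := by
  rw [← integral_primitiveKernel (abs_centre_le x) (by fun_prop)]
  exact integral_comp_centre (fun u => primitiveKernel (centre x) u *
    Complex.exp ((-(2 * Real.pi * t * u) : ℝ) * Complex.I))

lemma mul_integral_exp (t c : ℝ) (ht : t ≠ 0) :
    -(2 * Real.pi * Complex.I) *
      ∫ u in (0 : ℝ)..c, Complex.exp ((-(2 * Real.pi * t * u) : ℝ) * Complex.I) =
    (t : ℂ)⁻¹ * (Complex.exp ((-(2 * Real.pi * t * c) : ℝ) * Complex.I) - 1) := by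
  have hc : (-(2 * Real.pi * t) * Complex.I : ℂ) ≠ 0 := by
    simp [Real.pi_ne_zero, ht]
  have e : ∀ u : ℝ, ((-(2 * Real.pi * t * u) : ℝ) * Complex.I : ℂ) =
      (-(2 * Real.pi * t) * Complex.I : ℂ) * u := fun u => by push_cast; ring
  simp_rw [e]
  rw [integral_exp_mul_complex hc]
  have hpi : (Real.pi : ℂ) ≠ 0 := by exact_mod_cast Real.pi_ne_zero
  have ht' : (t : ℂ) ≠ 0 := by exact_mod_cast ht
  have hI := Complex.I_ne_zero
  simp only [Complex.ofReal_zero, mul_zero, Complex.exp_zero]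
  field_simp

/-- Writing the difference quotient as an integral over `[0, c]` removes the division by `t`, so
that `t = 0` needs no separate formula. -/
lemma Psi_eq_integral (a b : L2Z) (t : ℝ) :
    Psi a b t = ∫ x, density a b x * (-(2 * Real.pi * Complex.I) *
      ∫ u in (0 : ℝ)..centre x, Complex.exp ((-(2 * Real.pi * t * u) : ℝ) * Complex.I))
        ∂haarAddCircle := by
  rcases eq_or_ne t 0 with rfl | ht
  · have h := pairing_H_pow a b 1
    rw [pow_one] at h
    rw [Psi, if_pos rfl, h]
    refine integral_congr_ae (Filter.Eventually.of_forall fun x => ?_)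
    simp [symbol]
    ring
  · have h0 := pairing_H_pow a b 0
    have hexp : Integrable (fun x => Complex.exp (t * symbol x) * density a b x)
        (haarAddCircle (T := 1)) := by
      simp_rw [exp_mul_symbol]
      exact (integrable_density a b).bdd_mul (c := 1)
        (measurable_expFun t).aestronglyMeasurable
        (Filter.Eventually.of_forall fun x => (norm_expFun t x).le)
    simp only [pow_zero, one_apply_eq_self, one_mul] at h0
    have h1 : pairing ((t : ℂ)⁻¹ • (NormedSpace.exp ((t : ℂ) • H) a - a)) b =
        (t : ℂ)⁻¹ * (pairing (NormedSpace.exp ((t : ℂ) • H) a) b - pairing a b) := by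
      rw [pairing, pairing, pairing, inner_smul_right, inner_sub_right]
    rw [Psi, if_neg ht, h1, pairing_exp_H, h0, ← integral_sub hexp (integrable_density a b),
      ← integral_const_mul]
    refine integral_congr_ae (Filter.Eventually.of_forall fun x => ?_)
    simp only
    rw [mul_integral_exp t _ ht, exp_mul_symbol, expFun]
    ring

/-- `Ψ` is a bounded linear functional evaluated along the exponentials. -/
lemma exists_functional_Psi (a b : L2Z) :
    ∃ φ : L2Circle →L[ℂ] ℂ, ∀ t : ℝ, Psi a b t = φ (expVec t) := by
  set μ := haarAddCircle (T := 1)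
  set F : UnitAddCircle → UnitAddCircle → ℂ :=
    fun x y => density a b x * primitiveKernel (centre x) (centre y) with hF
  have hk : Measurable fun p : UnitAddCircle × UnitAddCircle =>
      primitiveKernel (centre p.1) (centre p.2) :=
    measurable_primitiveKernel.comp
      ((measurable_centre.comp measurable_fst).prodMk (measurable_centre.comp measurable_snd))
  have hFint : Integrable (Function.uncurry F) (μ.prod μ) := by
    have h1 : Integrable (fun p : UnitAddCircle × UnitAddCircle => density a b p.1) (μ.prod μ) :=
      (integrable_density a b).comp_fst μ
    exact h1.mul_bdd (c := 2) hk.aestronglyMeasurable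
      (Filter.Eventually.of_forall fun p => norm_primitiveKernel_le _ _)
  -- Integrating the `L¹` density against a bounded kernel yields a bounded function, hence one in
  -- `L²`; this is where the smoothing by the primitive is needed.
  set g : UnitAddCircle → ℂ := fun y => ∫ x, F x y ∂μ with hg
  have hgm : AEStronglyMeasurable g μ := hFint.integral_prod_right.aestronglyMeasurable
  have hgb : ∀ y, ‖g y‖ ≤ 2 * ∫ x, ‖density a b x‖ ∂μ := by
    intro y
    refine (norm_integral_le_integral_norm _).trans ?_
    rw [← integral_const_mul]
    refine integral_mono_of_nonneg (Filter.Eventually.of_forall fun x => norm_nonneg _)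
      ((integrable_density a b).norm.const_mul 2) (Filter.Eventually.of_forall fun x => ?_)
    simp only [hF, norm_mul]
    rw [mul_comm]
    exact mul_le_mul_of_nonneg_right (norm_primitiveKernel_le _ _) (norm_nonneg _)
  have hg2 : MemLp (fun y => (starRingEnd ℂ) (g y)) 2 μ :=
    MemLp.of_bound (Complex.continuous_conj.comp_aestronglyMeasurable hgm)
      (2 * ∫ x, ‖density a b x‖ ∂μ)
      (Filter.Eventually.of_forall fun y => by rw [RCLike.norm_conj]; exact hgb y)
  refine ⟨(-(2 * Real.pi * Complex.I) : ℂ) • innerSL ℂ (hg2.toLp _), fun t => ?_⟩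
  have h1 : inner ℂ (hg2.toLp _) (expVec t) = ∫ y, g y * expFun t y ∂μ := by
    rw [L2.inner_def]
    refine integral_congr_ae ?_
    filter_upwards [hg2.coeFn_toLp, coeFn_expVec t] with y h1 h2
    rw [h1, h2]
    simp [mul_comm]
  rw [smul_apply, innerSL_apply_apply, h1, Psi_eq_integral, smul_eq_mul]
  have h2 : ∫ y, g y * expFun t y ∂μ = ∫ x, ∫ y, F x y * expFun t y ∂μ ∂μ := by
    rw [integral_integral_swap]
    · simp_rw [hg, integral_mul_const]
    · exact hFint.mul_bdd (c := 1)
        ((measurable_expFun t).comp measurable_snd).aestronglyMeasurable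
        (Filter.Eventually.of_forall fun p => (norm_expFun t p.2).le)
  rw [h2, ← integral_const_mul]
  refine integral_congr_ae (Filter.Eventually.of_forall fun x => ?_)
  have h3 : ∀ y, F x y * expFun t y =
      density a b x * (primitiveKernel (centre x) (centre y) * expFun t y) :=
    fun y => mul_assoc _ _ _
  simp_rw [h3]
  rw [integral_const_mul, integral_primitiveKernel_expFun]
  ring

end Psi

/-! ### Kadec's 1/4-theorem. -/

section Kadec

lemma hasSum_int_of_even_of_odd {M : Type*} [AddCommMonoid M] [TopologicalSpace M]
    [ContinuousAdd M] {f : ℤ → M} {a b : M} (ha : HasSum (fun n : ℤ => f (2 * n)) a)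
    (hb : HasSum (fun n : ℤ => f (2 * n + 1)) b) : HasSum f (a + b) := by
  have h0 : Function.Injective fun n : ℤ => 2 * n := fun m n h => by simpa using h
  have h1 : Function.Injective fun n : ℤ => 2 * n + 1 := fun m n h => by simpa using h
  have hc : IsCompl (Set.range fun n : ℤ => 2 * n) (Set.range fun n : ℤ => 2 * n + 1) := by
    have := Int.isCompl_even_odd
    convert! this using 1
    · ext n; simp [even_iff_exists_two_mul]
    · ext n; simp [Odd]
  exact HasSum.add_isCompl hc (h0.hasSum_range_iff.2 ha) (h1.hasSum_range_iff.2 hb)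

/-- Each half telescopes to `2`, because `1/((n + 1/2)(n + 3/2)) = 1/(n + 1/2) - 1/(n + 3/2)`. -/
lemma hasSum_inv_sq_sub_quarter :
    HasSum (fun m : ℤ => if m = 0 then (0 : ℝ) else 1 / ((m : ℝ) ^ 2 - 1 / 4)) 4 := by
  have key : HasSum (fun n : ℕ => 1 / (((n : ℝ) + 1) ^ 2 - 1 / 4)) 2 := by
    have hn : ∀ n : ℕ, 1 / (((n : ℝ) + 1) ^ 2 - 1 / 4) =
        -(1 / (((n + 1 : ℕ) : ℝ) + 1 / 2)) - -(1 / ((n : ℝ) + 1 / 2)) := by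
      intro n
      have h1 : (0 : ℝ) < n + 1 / 2 := by positivity
      have h2 : (0 : ℝ) < n + 3 / 2 := by positivity
      have e : ((n : ℝ) + 1) ^ 2 - 1 / 4 = (n + 1 / 2) * (n + 3 / 2) := by ring
      have e2 : (((n + 1 : ℕ) : ℝ) + 1 / 2) = n + 3 / 2 := by push_cast; ring
      rw [e, e2]
      field_simp
      ring
    rw [hasSum_iff_tendsto_nat_of_nonneg]
    · simp_rw [hn]
      simp_rw [Finset.sum_range_sub (fun n : ℕ => -(1 / ((n : ℝ) + 1 / 2)))]
      have h0 : Filter.Tendsto (fun n : ℕ => 1 / ((n : ℝ) + 1 / 2)) Filter.atTop (nhds 0) := by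
        refine Filter.Tendsto.div_atTop tendsto_const_nhds ?_
        exact Filter.tendsto_atTop_add_const_right _ _ tendsto_natCast_atTop_atTop
      have h1 := h0.neg.sub_const (-(1 / (((0 : ℕ) : ℝ) + 1 / 2)))
      convert h1 using 2
      norm_num
    · intro n
      have : (0 : ℝ) ≤ n := Nat.cast_nonneg n
      have : (0 : ℝ) < ((n : ℝ) + 1) ^ 2 - 1 / 4 := by nlinarith
      positivity
  have h := HasSum.of_add_one_of_neg_add_one
    (f := fun m : ℤ => if m = 0 then (0 : ℝ) else 1 / ((m : ℝ) ^ 2 - 1 / 4)) (m := 2) (m' := 2)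
    ?_ ?_
  · norm_num at h
    simpa using h
  · convert key using 2 with n
    rw [if_neg (by omega)]
    push_cast; rfl
  · convert key using 2 with n
    rw [if_neg (by omega)]
    push_cast
    congr 2
    ring

/-- The coefficients of `1 - exp (-2πi δ x)` on `[-1/2, 1/2)` in terms of the exponentials of
half-integer frequency: cosines of integer frequency for the even part, sines of half-integer
frequency for the odd part. -/
def kadecCoeff (m : ℤ) (δ : ℝ) : ℝ :=
  (if m = 0 then 1 else 0) - 2⁻¹ * (Real.sinc (Real.pi * (δ - m / 2)) +
    (-1) ^ m * Real.sinc (Real.pi * (δ + m / 2)))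

lemma hasSum_expVec (f : L2Circle) :
    HasSum (fun n : ℤ => (inner ℂ (expVec n) f : ℂ) • expVec n) f := by
  have h := expBasis.hasSum_repr f
  simpa [HilbertBasis.repr_apply_apply, expBasis_apply] using h

/-- The even part `1 - cos` is expanded in the integer exponentials. The odd part is first
multiplied by `e_{-1/2}`, expanded there, and modulated back, which produces half-integer
frequencies. This choice gives coefficients of order `m⁻²`, whereas integer frequencies alone would
give only order `m⁻¹`. -/
lemma hasSum_kadecCoeff (δ : ℝ) :
    HasSum (fun m : ℤ => (kadecCoeff m δ : ℂ) • expVec (m / 2 : ℝ)) (expVec 0 - expVec δ) := by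
  have h1 := hasSum_expVec (expVec 0 - (2⁻¹ : ℂ) • (expVec δ + expVec (-δ)))
  have h2 := (hasSum_expVec ((2⁻¹ : ℂ) • (expVec (-δ - 1 / 2) - expVec (δ - 1 / 2)))).mapL
    (modulation (1 / 2))
  have e : expVec 0 - expVec δ = (expVec 0 - (2⁻¹ : ℂ) • (expVec δ + expVec (-δ))) +
      modulation (1 / 2) ((2⁻¹ : ℂ) • (expVec (-δ - 1 / 2) - expVec (δ - 1 / 2))) := by
    rw [map_smul, map_sub, modulation_expVec, modulation_expVec]
    rw [show 1 / 2 + (-δ - 1 / 2) = -δ by ring, show 1 / 2 + (δ - 1 / 2) = δ by ring]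
    module
  rw [e]
  refine hasSum_int_of_even_of_odd ?_ ?_
  · convert h1 using 2 with n
    have e1 : (((2 * n : ℤ) : ℝ) / 2) = n := by push_cast; ring
    have e2 : (-1 : ℝ) ^ (2 * n) = 1 := by rw [zpow_mul]; norm_num
    have e3 : Real.sinc (Real.pi * (-δ - n)) = Real.sinc (Real.pi * (δ + n)) := by
      rw [← Real.sinc_neg]; congr 1; ring
    have e4 : Real.sinc (Real.pi * (0 - (n : ℝ))) = if n = 0 then 1 else 0 := by
      rw [← sinc_pi_mul_int, ← Real.sinc_neg]; congr 1; ring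
    rw [inner_sub_right, inner_smul_right, inner_add_right, inner_expVec, inner_expVec,
      inner_expVec, kadecCoeff, e1, e2, e3, e4]
    congr 1
    by_cases hn : n = 0 <;> simp [hn]
  · convert h2 using 2 with n
    have e1 : (((2 * n + 1 : ℤ) : ℝ) / 2) = 1 / 2 + n := by push_cast; ring
    have e2 : (-1 : ℝ) ^ (2 * n + 1) = -1 := by
      rw [zpow_add₀ (by norm_num), zpow_mul]; norm_num
    have e3 : Real.sinc (Real.pi * (-δ - 1 / 2 - n)) = Real.sinc (Real.pi * (δ + (1 / 2 + n))) := by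
      rw [← Real.sinc_neg]; congr 1; ring
    have e4 : δ - 1 / 2 - (n : ℝ) = δ - (1 / 2 + n) := by ring
    rw [map_smul, modulation_expVec, inner_smul_right, inner_sub_right, inner_expVec,
      inner_expVec, kadecCoeff, e1, e2, e3, e4, if_neg (by omega)]
    congr 1
    push_cast
    ring

/-- By parity one of `sin(πm/2)` and `cos(πm/2)` vanishes in the addition formulas, and the two
fractions combine over `δ² - (m/2)²`. -/
lemma kadecCoeff_eq {m : ℤ} (hm : m ≠ 0) {δ : ℝ} (hδ : |δ| < 1 / 2) :
    kadecCoeff m δ =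
      -(if Even m then Real.cos (Real.pi * (m / 2)) * (δ * Real.sin (Real.pi * δ))
        else -(Real.sin (Real.pi * (m / 2)) * (δ * Real.cos (Real.pi * δ)))) /
        (Real.pi * (δ ^ 2 - (m / 2) ^ 2)) := by
  have hm1 : (1 : ℝ) ≤ |(m : ℝ)| := by exact_mod_cast Int.one_le_abs hm
  have h1 : δ - m / 2 ≠ 0 := fun h => by
    have : δ = m / 2 := by linarith
    rw [this, abs_div, abs_two] at hδ
    linarith
  have h2 : δ + m / 2 ≠ 0 := fun h => by
    have : δ = -(m / 2) := by linarith
    rw [this, abs_neg, abs_div, abs_two] at hδ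
    linarith
  have hpi := Real.pi_ne_zero
  have h3 : δ ^ 2 - (m / 2) ^ 2 = (δ - m / 2) * (δ + m / 2) := by ring
  have h4 : Real.sin (Real.pi * (δ - m / 2)) = Real.sin (Real.pi * δ) * Real.cos (Real.pi * (m / 2))
      - Real.cos (Real.pi * δ) * Real.sin (Real.pi * (m / 2)) := by
    rw [mul_sub, Real.sin_sub]
  have h5 : Real.sin (Real.pi * (δ + m / 2)) = Real.sin (Real.pi * δ) * Real.cos (Real.pi * (m / 2))
      + Real.cos (Real.pi * δ) * Real.sin (Real.pi * (m / 2)) := by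
    rw [mul_add, Real.sin_add]
  rw [kadecCoeff, if_neg hm, Real.sinc_of_ne_zero (mul_ne_zero hpi h1),
    Real.sinc_of_ne_zero (mul_ne_zero hpi h2), h3, h4, h5]
  rcases Int.even_or_odd m with he | ho
  · rw [if_pos he, he.neg_one_zpow]
    obtain ⟨n, rfl⟩ := he
    have hs : Real.sin (Real.pi * (((n + n : ℤ) : ℝ) / 2)) = 0 := by
      rw [show Real.pi * (((n + n : ℤ) : ℝ) / 2) = n * Real.pi by push_cast; ring]
      exact Real.sin_int_mul_pi n
    rw [hs]
    generalize ((n + n : ℤ) : ℝ) / 2 = w at h1 h2 ⊢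
    field_simp
    ring
  · rw [if_neg (Int.not_even_iff_odd.2 ho), ho.neg_one_zpow]
    obtain ⟨n, rfl⟩ := ho
    have hs : Real.cos (Real.pi * (((2 * n + 1 : ℤ) : ℝ) / 2)) = 0 := by
      rw [Real.cos_eq_zero_iff]
      exact ⟨n, by push_cast; ring⟩
    rw [hs]
    generalize ((2 * n + 1 : ℤ) : ℝ) / 2 = w at h1 h2 ⊢
    field_simp
    ring

/-- The number `√2/8` is the common value of `δ sin πδ` and `δ cos πδ` at `δ = 1/4`, so `ρ` measures
the gain over that extremal case. The denominator bound uses only `δ² ≤ 1/16`. -/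
lemma abs_kadecCoeff_le {m : ℤ} (hm : m ≠ 0) {δ ρ : ℝ} (hδ : |δ| ≤ 1 / 4) (hρ : |δ| ≤ ρ / 4)
    (hcos : |δ| * Real.cos (Real.pi * δ) ≤ ρ * (√2 / 8)) :
    |kadecCoeff m δ| ≤ ρ * (√2 / (2 * Real.pi)) * (1 / ((m : ℝ) ^ 2 - 1 / 4)) := by
  have hm1 : (1 : ℝ) ≤ (m : ℝ) ^ 2 := by
    have : (1 : ℝ) ≤ |(m : ℝ)| := by exact_mod_cast Int.one_le_abs hm
    rw [← sq_abs]; nlinarith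
  have hδ2 : δ ^ 2 ≤ 1 / 16 := by
    rw [← sq_abs]; nlinarith [abs_nonneg δ]
  have hpi := Real.pi_pos
  have h2 : (0 : ℝ) ≤ √2 := Real.sqrt_nonneg 2
  have hpδ : |Real.pi * δ| ≤ Real.pi / 4 := by
    rw [abs_mul, abs_of_pos hpi]; nlinarith
  have hcos0 : 0 ≤ Real.cos (Real.pi * δ) := by
    refine Real.cos_nonneg_of_mem_Icc ⟨?_, ?_⟩ <;> have := abs_le.1 hpδ <;> linarith
  have hsin : |Real.sin (Real.pi * δ)| ≤ √2 / 2 := by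
    rw [← Real.sin_pi_div_four, abs_le, ← Real.sin_neg]
    have := abs_le.1 hpδ
    constructor <;> refine Real.sin_le_sin_of_le_of_le_pi_div_two ?_ ?_ ?_ <;> linarith
  have hnum : |(if Even m then Real.cos (Real.pi * (m / 2)) * (δ * Real.sin (Real.pi * δ))
        else -(Real.sin (Real.pi * (m / 2)) * (δ * Real.cos (Real.pi * δ))))| ≤ ρ * (√2 / 8) := by
    split_ifs
    · rw [abs_mul, abs_mul]
      calc _ ≤ 1 * (ρ / 4 * (√2 / 2)) := by
            refine mul_le_mul (Real.abs_cos_le_one _) ?_ (by positivity) zero_le_one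
            exact mul_le_mul hρ hsin (abs_nonneg _) ((abs_nonneg _).trans hρ)
        _ = _ := by ring
    · rw [abs_neg, abs_mul, abs_mul, abs_of_nonneg hcos0]
      calc _ ≤ 1 * (ρ * (√2 / 8)) := by
            refine mul_le_mul (Real.abs_sin_le_one _) hcos ?_ zero_le_one
            positivity
        _ = _ := by ring
  rw [kadecCoeff_eq hm (by linarith), abs_div, abs_neg, abs_mul, abs_of_pos hpi]
  have hden : ((m : ℝ) ^ 2 - 1 / 4) / 4 ≤ |δ ^ 2 - (m / 2) ^ 2| := by
    rw [abs_sub_comm]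
    refine le_trans ?_ (le_abs_self _)
    linarith
  have hpos : 0 < (m : ℝ) ^ 2 - 1 / 4 := by linarith
  have hn0 := (abs_nonneg _).trans hnum
  calc _ ≤ ρ * (√2 / 8) / (Real.pi * (((m : ℝ) ^ 2 - 1 / 4) / 4)) := by
        refine div_le_div₀ hn0 hnum (by positivity) ?_
        exact mul_le_mul_of_nonneg_left hden hpi.le
    _ = _ := by field_simp; ring

/-- The coefficient is `1 - sinc(πδ)`, and `2√2/π = sinc(π/4)`. By concavity the sine lies above its
chord on `[0, π/4]`. -/
lemma abs_kadecCoeff_zero_le {δ : ℝ} (hδ : |δ| ≤ 1 / 4) :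
    |kadecCoeff 0 δ| ≤ 1 - 2 * √2 / Real.pi := by
  have e : kadecCoeff 0 δ = 1 - Real.sinc (Real.pi * δ) := by
    simp [kadecCoeff]; ring
  have hpi := Real.pi_pos
  rw [e, abs_of_nonneg (by linarith [Real.sinc_le_one (Real.pi * δ)])]
  have key : ∀ x : ℝ, 0 ≤ x → x ≤ 1 / 4 → 2 * √2 / Real.pi ≤ Real.sinc (Real.pi * x) := by
    intro x hx0 hx
    rcases hx0.eq_or_lt with rfl | hx0
    · rw [mul_zero, Real.sinc_zero, div_le_one hpi]
      have h2 : √2 ≤ 1.5 := by rw [Real.sqrt_le_left (by norm_num)]; norm_num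
      linarith [Real.pi_gt_three]
    rw [Real.sinc_of_ne_zero (by positivity), div_le_div_iff₀ hpi (by positivity)]
    have h0 : (0 : ℝ) ∈ Set.Icc 0 Real.pi := ⟨le_rfl, hpi.le⟩
    have h1 : Real.pi / 4 ∈ Set.Icc 0 Real.pi := ⟨by positivity, by linarith⟩
    have hc := strictConcaveOn_sin_Icc.concaveOn.2 h0 h1 (show 0 ≤ 1 - 4 * x by linarith)
      (show 0 ≤ 4 * x by linarith) (by ring)
    simp only [smul_eq_mul, Real.sin_zero, mul_zero, zero_add, Real.sin_pi_div_four] at hc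
    have e2 : 4 * x * (Real.pi / 4) = Real.pi * x := by ring
    rw [e2] at hc
    nlinarith
  have := key |δ| (abs_nonneg δ) hδ
  rcases abs_choice δ with h | h <;> rw [h] at this
  · linarith
  · rw [mul_neg, Real.sinc_neg] at this; linarith

/-- The cosine is bounded by its tangent line at `π/4`; the resulting quadratic `x(1 + π(1/4 - x))`
increases on `[0, 1/4]` because `π < 4`. -/
lemma mul_cos_pi_mul_le {L δ : ℝ} (hL : L ≤ 1 / 4) (hδ : |δ| ≤ L) :
    |δ| * Real.cos (Real.pi * δ) ≤ 4 * L * (1 + Real.pi * (1 / 4 - L)) * (√2 / 8) := by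
  have hpi := Real.pi_pos
  have hpi4 := Real.pi_lt_four
  have hc : Real.cos (Real.pi * δ) = Real.cos (Real.pi * |δ|) := by
    rcases abs_choice δ with h | h <;> rw [h]
    rw [mul_neg, Real.cos_neg]
  rw [hc]
  set x := |δ|
  have hx0 : 0 ≤ x := abs_nonneg δ
  have hx : x ≤ 1 / 4 := hδ.trans hL
  have h2 : (0 : ℝ) ≤ √2 := Real.sqrt_nonneg 2
  have h22 : √2 * √2 = 2 := Real.mul_self_sqrt (by norm_num)
  have h1 : Real.cos (Real.pi * x) ≤ √2 / 2 * (1 + Real.pi * (1 / 4 - x)) := by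
    have e : Real.pi * x = Real.pi / 4 - Real.pi * (1 / 4 - x) := by ring
    set y := Real.pi * (1 / 4 - x)
    have hy : 0 ≤ y := mul_nonneg hpi.le (by linarith)
    rw [e, Real.cos_sub, Real.cos_pi_div_four, Real.sin_pi_div_four]
    have := Real.sin_le hy
    have := Real.cos_le_one y
    nlinarith
  have h3 : x * (1 + Real.pi * (1 / 4 - x)) ≤ L * (1 + Real.pi * (1 / 4 - L)) := by
    have : 0 ≤ (L - x) * (1 + Real.pi * (1 / 4 - L - x)) :=
      mul_nonneg (by linarith) (by nlinarith)
    nlinarith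
  calc x * Real.cos (Real.pi * x) ≤ x * (√2 / 2 * (1 + Real.pi * (1 / 4 - x))) :=
        mul_le_mul_of_nonneg_left h1 hx0
    _ = √2 / 2 * (x * (1 + Real.pi * (1 / 4 - x))) := by ring
    _ ≤ √2 / 2 * (L * (1 + Real.pi * (1 / 4 - L))) := mul_le_mul_of_nonneg_left h3 (by positivity)
    _ = _ := by ring

/-- The synthesis operator of the integer exponentials. -/
def synthesis : L2Z →L[ℂ] L2Circle := expBasis.repr.symm.toContinuousLinearEquiv

lemma synthesis_single (k : ℤ) (c : ℂ) : synthesis (lp.single 2 k c) = c • expVec k := by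
  have e : lp.single 2 k c = c • (lp.single 2 k (1 : ℂ) : L2Z) := by
    rw [← lp.single_smul]; simp
  have h : synthesis (lp.single 2 k (1 : ℂ)) = expVec k := by
    rw [← expBasis_apply, ← HilbertBasis.repr_symm_single]
    rfl
  rw [e, map_smul, h]

lemma norm_synthesis_apply (x : L2Z) : ‖synthesis x‖ = ‖x‖ :=
  expBasis.repr.symm.norm_map x

lemma norm_synthesis_le : ‖synthesis‖ ≤ 1 :=
  ContinuousLinearMap.opNorm_le_bound _ zero_le_one fun x => by
    rw [norm_synthesis_apply, one_mul]

/-- A bounded diagonal operator on `l²`. -/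
def diagOp (d : ℤ → ℝ) {C : ℝ} (hC : 0 ≤ C) (hd : ∀ k, |d k| ≤ C) : L2Z →L[ℂ] L2Z :=
  lp.mapCLM 2 (fun k => ContinuousLinearMap.mul ℂ ℂ (d k : ℂ)) hC
    (fun k => by simpa using hd k)

lemma norm_diagOp_le (d : ℤ → ℝ) {C : ℝ} (hC : 0 ≤ C) (hd : ∀ k, |d k| ≤ C) :
    ‖diagOp d hC hd‖ ≤ C := lp.norm_mapCLM_le _ _ _ _

lemma diagOp_single (d : ℤ → ℝ) {C : ℝ} (hC : 0 ≤ C) (hd : ∀ k, |d k| ≤ C) (k : ℤ) :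
    diagOp d hC hd (lp.single 2 k 1) = lp.single 2 k (d k : ℂ) := by
  ext m
  change (d m : ℂ) * (lp.single 2 k (1 : ℂ) : L2Z) m = (lp.single 2 k (d k : ℂ) : L2Z) m
  by_cases h : m = k
  · subst h; simp
  · rw [lp.single_apply_ne _ _ _ h, lp.single_apply_ne _ _ _ h, mul_zero]

/-- Kadec's estimate: the perturbation of the exponential system is a strict contraction. -/
lemma exists_kadec_perturbation (τ : ℤ → ℝ) {L : ℝ} (hL : L < 1 / 4)
    (hτ : ∀ k : ℤ, |τ k - (k : ℝ)| ≤ L) :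
    ∃ B : L2Z →L[ℂ] L2Circle, ‖B‖ < 1 ∧
      ∀ k, B (lp.single 2 k 1) = expVec k - expVec (τ k) := by
  have hpi := Real.pi_pos
  have hL0 : 0 ≤ L := (abs_nonneg _).trans (hτ 0)
  set ρ := 4 * L * (1 + Real.pi * (1 / 4 - L)) with hρ
  have hρ0 : 0 ≤ ρ := by
    have : 0 ≤ Real.pi * (1 / 4 - L) := mul_nonneg hpi.le (by linarith)
    positivity
  have hρL : L ≤ ρ / 4 := by
    have : 0 ≤ L * (Real.pi * (1 / 4 - L)) :=
      mul_nonneg hL0 (mul_nonneg hpi.le (by linarith))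
    rw [hρ]; linarith
  have hρ1 : ρ < 1 := by
    -- Here `1 - ρ = 4(1/4 - L)(1 - πL)`.
    have h4 := Real.pi_lt_four
    have : 0 < (1 / 4 - L) * (1 - Real.pi * L) := mul_pos (by linarith) (by nlinarith)
    rw [hρ]; nlinarith
  have hs2 : 0 < √2 := by positivity
  have hs0 : 0 ≤ 1 - 2 * √2 / Real.pi :=
    (abs_nonneg _).trans (abs_kadecCoeff_zero_le (δ := 0) (by norm_num))
  -- The majorants sum to `1 - (1 - ρ) 2√2/π`, which equals `1` exactly at the critical value `ρ =
  -- 1`.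
  set C : ℤ → ℝ := fun m => (if m = 0 then 1 - 2 * √2 / Real.pi else 0) +
    ρ * (√2 / (2 * Real.pi)) * (if m = 0 then 0 else 1 / ((m : ℝ) ^ 2 - 1 / 4)) with hC
  have hCsum : HasSum C (1 - 2 * √2 / Real.pi + ρ * (√2 / (2 * Real.pi)) * 4) := by
    refine HasSum.add ?_ (hasSum_inv_sq_sub_quarter.mul_left _)
    exact hasSum_ite_eq 0 _
  have hCb : ∀ m k, |kadecCoeff m (τ k - k)| ≤ C m := by
    intro m k
    have hk := hτ k
    rcases eq_or_ne m 0 with rfl | hm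
    · simpa [hC] using abs_kadecCoeff_zero_le (hk.trans hL.le)
    · simpa [hC, hm] using abs_kadecCoeff_le hm (hk.trans hL.le) (hk.trans hρL)
        (mul_cos_pi_mul_le hL.le hk)
  have hC0 : ∀ m, 0 ≤ C m := fun m => (abs_nonneg _).trans (hCb m 0)
  -- The sum over `m` sends `δ_k` to `e_k ∑ c_m(t_k - k) e_{m/2} = e_k (1 - e_{t_k - k}) = e_k -
  -- e_{t_k}`; grouping by `m` makes the norms summable.
  set X : ℤ → (L2Z →L[ℂ] L2Circle) := fun m =>
    modulation (m / 2) ∘L synthesis ∘L diagOp (fun k => kadecCoeff m (τ k - k)) (hC0 m) (hCb m)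
    with hX
  have hXb : ∀ m, ‖X m‖ ≤ C m := by
    intro m
    have h1 := (modulation (m / 2)).opNorm_comp_le
      (synthesis ∘L diagOp (fun k => kadecCoeff m (τ k - k)) (hC0 m) (hCb m))
    have h2 := synthesis.opNorm_comp_le
      (diagOp (fun k => kadecCoeff m (τ k - k)) (hC0 m) (hCb m))
    have h3 := norm_diagOp_le (fun k => kadecCoeff m (τ k - k)) (hC0 m) (hCb m)
    have h4 := norm_modulation_le (m / 2)
    have h5 := norm_synthesis_le
    refine h1.trans ((mul_le_of_le_one_left (norm_nonneg _) h4).trans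
      (h2.trans ((mul_le_of_le_one_left (norm_nonneg _) h5).trans h3)))
  have hXs : Summable X := Summable.of_norm_bounded hCsum.summable hXb
  refine ⟨∑' m, X m, ?_, fun k => ?_⟩
  · refine (tsum_of_norm_bounded hCsum hXb).trans_lt ?_
    have e : 1 - 2 * √2 / Real.pi + ρ * (√2 / (2 * Real.pi)) * 4 =
        1 - (1 - ρ) * (2 * √2 / Real.pi) := by
      field_simp; ring
    rw [e]
    have : 0 < (1 - ρ) * (2 * √2 / Real.pi) := mul_pos (by linarith) (by positivity)
    linarith
  · have h1 := hXs.hasSum.mapL (ContinuousLinearMap.apply ℂ L2Circle (lp.single 2 k (1 : ℂ) : L2Z))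
    refine h1.unique ?_
    have h2 := (hasSum_kadecCoeff (τ k - k)).mapL (modulation k)
    rw [map_sub, modulation_expVec, modulation_expVec, add_zero, add_sub_cancel] at h2
    convert! h2 using 2 with m
    rw [ContinuousLinearMap.apply_apply, map_smul, modulation_expVec, hX]
    simp only [ContinuousLinearMap.comp_apply]
    rw [diagOp_single, synthesis_single, map_smul, modulation_expVec, add_comm]

/-- Neumann series: `synthesis` is a unitary `V`, and `D = V(1 - R)` with `‖R‖ < 1`. -/
lemma exists_equiv_of_norm_sub_lt_one (D : L2Z →L[ℂ] L2Circle) (hD : ‖synthesis - D‖ < 1) :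
    ∃ T : L2Z ≃L[ℂ] L2Circle, ∀ x, T x = D x := by
  set V : L2Z ≃L[ℂ] L2Circle := expBasis.repr.symm.toContinuousLinearEquiv with hV
  set R : L2Z →L[ℂ] L2Z := (V.symm : L2Circle →L[ℂ] L2Z) ∘L (synthesis - D) with hR
  have hR1 : ‖R‖ < 1 := by
    refine lt_of_le_of_lt ?_ hD
    refine ContinuousLinearMap.opNorm_le_bound _ (norm_nonneg _) fun x => ?_
    have h1 : ‖R x‖ = ‖(synthesis - D) x‖ := expBasis.repr.norm_map _
    rw [h1]
    exact (synthesis - D).le_opNorm x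
  refine ⟨(ContinuousLinearEquiv.unitsEquiv ℂ L2Z (Units.oneSub R hR1)).trans V, fun x => ?_⟩
  have h2 : V (R x) = synthesis x - D x := V.apply_symm_apply _
  have h3 : V x = synthesis x := rfl
  rw [ContinuousLinearEquiv.trans_apply, ContinuousLinearEquiv.unitsEquiv_apply, Units.val_oneSub,
    sub_apply, one_apply_eq_self, map_sub, h2, h3]
  abel

end Kadec

/-! ### Convergence and zeros of the canonical product. -/

section CanonicalProduct

variable {τ : ℤ → ℝ}

/-- With `p = t_{k+1}` and `q = t_{-(k+1)}` the difference is `(z² - z(p + q))/(pq)`. Since `p + q`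
stays bounded, pairing the nodes gains a factor `1/k` over the single factors. The constant `2`
rounds up `16/9`. -/
lemma norm_pairFactor_sub_one_le (hτ : ∀ k : ℤ, |τ k - (k : ℝ)| ≤ 1 / 4) (k : ℕ) {z : ℂ} {R : ℝ}
    (hz : ‖z‖ ≤ R) :
    ‖pairFactor τ (k + 1) z - 1‖ ≤ 2 * (R + R ^ 2) * (1 / ((k : ℝ) + 1) ^ 2) := by
  have hp := abs_le.1 (hτ ((k + 1 : ℕ) : ℤ))
  have hm := abs_le.1 (hτ (-((k + 1 : ℕ) : ℤ)))
  push_cast at hp hm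
  rw [pairFactor]
  push_cast
  set p := τ ((k : ℤ) + 1)
  set q := τ (-((k : ℤ) + 1))
  have hk : (0 : ℝ) ≤ k := Nat.cast_nonneg k
  have hp0 : 3 / 4 * ((k : ℝ) + 1) ≤ p := by linarith
  have hq0 : 3 / 4 * ((k : ℝ) + 1) ≤ -q := by linarith
  have hp1 : 0 < p := by linarith
  have hq1 : 0 < -q := by linarith
  have hpc : (p : ℂ) ≠ 0 := by exact_mod_cast hp1.ne'
  have hqc : (q : ℂ) ≠ 0 := by
    have : q ≠ 0 := by linarith
    exact_mod_cast this
  have e : (1 - z / (p : ℂ)) * (1 - z / (q : ℂ)) - 1 =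
      (z ^ 2 - z * ((p + q : ℝ) : ℂ)) / ((p * q : ℝ) : ℂ) := by
    push_cast
    field_simp
    ring
  have hR : 0 ≤ R := (norm_nonneg z).trans hz
  have hpq : 9 / 16 * ((k : ℝ) + 1) ^ 2 ≤ |p * q| := by
    rw [abs_mul, abs_of_pos hp1, ← abs_neg q, abs_of_pos hq1]
    nlinarith
  have hnum : ‖z ^ 2 - z * ((p + q : ℝ) : ℂ)‖ ≤ R ^ 2 + R := by
    refine (norm_sub_le _ _).trans ?_
    rw [norm_pow, norm_mul, Complex.norm_real, Real.norm_eq_abs]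
    have h1 : |p + q| ≤ 1 := abs_le.2 ⟨by linarith, by linarith⟩
    refine add_le_add (pow_le_pow_left₀ (norm_nonneg _) hz 2) ?_
    calc ‖z‖ * |p + q| ≤ R * 1 := mul_le_mul hz h1 (abs_nonneg _) hR
      _ = R := mul_one R
  rw [e, norm_div, Complex.norm_real, Real.norm_eq_abs]
  calc _ ≤ (R ^ 2 + R) / (9 / 16 * ((k : ℝ) + 1) ^ 2) :=
        div_le_div₀ (by positivity) hnum (by positivity) hpq
    _ = 16 / 9 * (R + R ^ 2) * (1 / ((k : ℝ) + 1) ^ 2) := by field_simp; ring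
    _ ≤ _ := by gcongr; norm_num

lemma summable_inv_succ_sq : Summable fun k : ℕ => 1 / ((k : ℝ) + 1) ^ 2 := by
  have h := (summable_nat_add_iff 1).2 (Real.summable_one_div_nat_pow.2 (one_lt_two))
  simpa using h

lemma summable_norm_pairFactor_sub_one (hτ : ∀ k : ℤ, |τ k - (k : ℝ)| ≤ 1 / 4) (z : ℂ) :
    Summable fun k : ℕ => ‖pairFactor τ (k + 1) z - 1‖ :=
  Summable.of_nonneg_of_le (fun _ => norm_nonneg _)
    (fun k => norm_pairFactor_sub_one_le hτ k le_rfl) (summable_inv_succ_sq.mul_left _)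

lemma multipliable_pairFactor (hτ : ∀ k : ℤ, |τ k - (k : ℝ)| ≤ 1 / 4) (z : ℂ) :
    Multipliable fun k : ℕ => pairFactor τ (k + 1) z := by
  have h := multipliable_one_add_of_summable (summable_norm_pairFactor_sub_one hτ z)
  simpa using h

lemma differentiable_pairFactor (τ : ℤ → ℝ) (k : ℕ) : Differentiable ℂ (pairFactor τ k) := by
  unfold pairFactor
  fun_prop

lemma differentiable_G (hτ : ∀ k : ℤ, |τ k - (k : ℝ)| ≤ 1 / 4) : Differentiable ℂ (G τ) := by
  have h : Differentiable ℂ fun z => ∏' k : ℕ, pairFactor τ (k + 1) z := by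
    intro z
    have h1 := Summable.hasProdLocallyUniformlyOn_nat_one_add
      (f := fun k w => pairFactor τ (k + 1) w - 1) (K := Metric.ball (0 : ℂ) (‖z‖ + 1))
      Metric.isOpen_ball
      (summable_inv_succ_sq.mul_left (2 * ((‖z‖ + 1) + (‖z‖ + 1) ^ 2)))
      (Filter.Eventually.of_forall fun k w hw =>
        norm_pairFactor_sub_one_le hτ k (mem_ball_zero_iff.1 hw).le)
      (fun k => ((differentiable_pairFactor τ (k + 1)).continuous.sub continuous_const).continuousOn)
    simp only [add_sub_cancel] at h1
    refine (h1.differentiableOn (Filter.Eventually.of_forall fun s => ?_)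
      Metric.isOpen_ball).differentiableAt (Metric.isOpen_ball.mem_nhds (by simp))
    refine DifferentiableOn.congr (DifferentiableOn.fun_finsetProd (u := s)
      (f := fun k => pairFactor τ (k + 1)) fun k _ =>
        (differentiable_pairFactor τ (k + 1)).differentiableOn) fun w _ => ?_
    simp
  unfold G
  exact (differentiable_id.sub_const _).mul h

lemma node_ne_zero (hτ : ∀ k : ℤ, |τ k - (k : ℝ)| ≤ 1 / 4) (k : ℤ) (hk : k ≠ 0) :
    (τ k : ℂ) ≠ 0 := by
  intro h0
  have h0' : τ k = 0 := by exact_mod_cast h0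
  have h1 := hτ k
  rw [h0', zero_sub, abs_neg] at h1
  have : (1 : ℝ) ≤ |(k : ℝ)| := by exact_mod_cast Int.one_le_abs hk
  linarith

lemma G_eq_zero_iff (hτ : ∀ k : ℤ, |τ k - (k : ℝ)| ≤ 1 / 4) (z : ℂ) :
    G τ z = 0 ↔ ∃ k : ℤ, z = (τ k : ℂ) := by
  have hfac : ∀ k : ℕ, pairFactor τ (k + 1) z = 0 ↔
      z = τ ((k + 1 : ℕ) : ℤ) ∨ z = τ (-((k + 1 : ℕ) : ℤ)) := by
    intro k
    rw [pairFactor, mul_eq_zero, sub_eq_zero, sub_eq_zero, eq_comm,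
      div_eq_one_iff_eq (node_ne_zero hτ _ (by omega)), eq_comm (a := (1 : ℂ)),
      div_eq_one_iff_eq (node_ne_zero hτ _ (by omega))]
  constructor
  · intro h
    rcases mul_eq_zero.1 h with h | h
    · exact ⟨0, sub_eq_zero.1 h⟩
    · by_contra! hz
      have hn : ∀ k : ℕ, 1 + (pairFactor τ (k + 1) z - 1) ≠ 0 := by
        intro k h1
        rw [add_sub_cancel, hfac] at h1
        rcases h1 with h1 | h1 <;> exact hz _ h1
      have := tprod_one_add_ne_zero_of_summable hn (summable_norm_pairFactor_sub_one hτ z)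
      simp only [add_sub_cancel] at this
      exact this h
  · rintro ⟨k, hk⟩
    rw [G]
    rcases eq_or_ne k 0 with rfl | hk0
    · rw [hk, sub_self, zero_mul]
    · obtain ⟨n, hn⟩ : ∃ n : ℕ, k = ((n + 1 : ℕ) : ℤ) ∨ k = -((n + 1 : ℕ) : ℤ) := by
        refine ⟨k.natAbs - 1, ?_⟩
        omega
      have h0 : pairFactor τ (n + 1) z = 0 := by
        rw [hfac, hk]
        rcases hn with rfl | rfl <;> simp
      rw [tprod_of_exists_eq_zero ⟨n, h0⟩, mul_zero]

lemma tendsto_G (hτ : ∀ k : ℤ, |τ k - (k : ℝ)| ≤ 1 / 4) (z : ℂ) :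
    Filter.Tendsto (fun N : ℕ => (z - τ 0) * ∏ k ∈ Finset.range N, pairFactor τ (k + 1) z)
      Filter.atTop (nhds (G τ z)) :=
  ((multipliable_pairFactor hτ z).hasProd.tendsto_prod_nat).const_mul _

/-- The constant is the product of the nodes of nonzero index; only its independence of `z` and its
nonvanishing matter later. -/
lemma prod_Icc_sub_eq (hτ : ∀ k : ℤ, |τ k - (k : ℝ)| ≤ 1 / 4) (N : ℕ) :
    ∃ ν : ℂ, ν ≠ 0 ∧ ∀ z : ℂ, ∏ k ∈ Finset.Icc (-(N : ℤ)) N, (z - τ k) =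
      ν * ((z - τ 0) * ∏ k ∈ Finset.range N, pairFactor τ (k + 1) z) := by
  induction N with
  | zero => exact ⟨1, one_ne_zero, fun z => by simp⟩
  | succ N ih =>
    obtain ⟨ν, hν, h⟩ := ih
    have h1 := node_ne_zero hτ ((N + 1 : ℕ) : ℤ) (by omega)
    have h2 := node_ne_zero hτ (-((N + 1 : ℕ) : ℤ)) (by omega)
    refine ⟨ν * (τ ((N + 1 : ℕ) : ℤ) * τ (-((N + 1 : ℕ) : ℤ))),
      mul_ne_zero hν (mul_ne_zero h1 h2), fun z => ?_⟩
    have e : Finset.Icc (-((N + 1 : ℕ) : ℤ)) ((N + 1 : ℕ) : ℤ) =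
        insert ((N + 1 : ℕ) : ℤ) (insert (-((N + 1 : ℕ) : ℤ)) (Finset.Icc (-(N : ℤ)) N)) := by
      ext j
      simp only [Finset.mem_Icc, Finset.mem_insert]
      omega
    rw [e, Finset.prod_insert, Finset.prod_insert, h, Finset.prod_range_succ, pairFactor]
    · field_simp
      ring
    · simp
    · simp only [Finset.mem_insert, Finset.mem_Icc]
      omega

end CanonicalProduct

/-! ### Finite coordinate projections of `l²`. -/

section Truncation

/-- The coordinate projection of `l²` onto a finite set of indices. -/
def truncation (S : Finset ℤ) : L2Z →L[ℂ] L2Z :=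
  ∑ k ∈ S, lp.singleContinuousLinearMap ℂ (fun _ : ℤ => ℂ) 2 k ∘L
    lp.evalCLM ℂ (fun _ : ℤ => ℂ) 2 k

lemma truncation_apply (S : Finset ℤ) (x : L2Z) :
    truncation S x = ∑ k ∈ S, (lp.single 2 k (x k) : L2Z) := by
  rw [truncation, sum_apply]
  rfl

lemma norm_truncation_apply_le (S : Finset ℤ) (x : L2Z) : ‖truncation S x‖ ≤ ‖x‖ := by
  have h1 := lp.norm_sum_single (p := 2) (E := fun _ : ℤ => ℂ) (by simp) (fun k => x k) S
  have h2 := lp.sum_rpow_le_norm_rpow (p := 2) (by simp) x S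
  rw [← h1, ← truncation_apply] at h2
  exact (Real.rpow_le_rpow_iff (norm_nonneg _) (norm_nonneg _) (by simp)).1 h2

lemma tendsto_truncation (x : L2Z) :
    Filter.Tendsto (fun S : Finset ℤ => truncation S x) Filter.atTop (nhds x) := by
  simp_rw [truncation_apply]
  exact lp.hasSum_single (by simp) x

lemma truncation_single (S : Finset ℤ) (k : ℤ) :
    truncation S (lp.single 2 k 1) = if k ∈ S then (lp.single 2 k 1 : L2Z) else 0 := by
  rw [truncation_apply]
  have h : ∀ j ∈ S, (lp.single 2 j ((lp.single 2 k (1 : ℂ) : L2Z) j) : L2Z) =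
      if j = k then lp.single 2 k 1 else 0 := by
    intro j _
    split_ifs with h
    · subst h; rw [lp.single_apply_self]
    · rw [lp.single_apply_ne _ _ _ h, lp.single_zero]
  rw [Finset.sum_congr rfl h, Finset.sum_ite_eq']

/-- Truncating the coordinate vectors makes partial sums converge uniformly on compact sets. -/
lemma tendstoUniformlyOn_truncation {f : ℝ → L2Z} (hf : Continuous f) {K : Set ℝ}
    (hK : IsCompact K) :
    TendstoUniformlyOn (fun (S : Finset ℤ) (t : ℝ) => truncation S (f t)) f Filter.atTop K := by
  rw [← tendstoLocallyUniformlyOn_iff_tendstoUniformlyOn_of_compact hK,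
    Metric.tendstoLocallyUniformlyOn_iff]
  intro ε hε t _
  have h1 := Metric.tendsto_nhds.1 (hf.tendsto t) (ε / 3) (by positivity)
  refine ⟨{s | dist (f s) (f t) < ε / 3}, mem_nhdsWithin_of_mem_nhds h1, ?_⟩
  filter_upwards [Metric.tendsto_nhds.1 (tendsto_truncation (f t)) (ε / 3) (by positivity)]
    with S hS s hs
  -- Contractivity makes the truncations equicontinuous, so pointwise convergence becomes locally
  -- uniform.
  have h2 : dist (truncation S (f s)) (truncation S (f t)) ≤ dist (f s) (f t) := by
    rw [dist_eq_norm, dist_eq_norm, ← map_sub]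
    exact norm_truncation_apply_le S _
  have h3 : dist (f s) (f t) < ε / 3 := hs
  rw [dist_comm] at hS
  have h4 := dist_triangle4 (f s) (f t) (truncation S (f t)) (truncation S (f s))
  rw [dist_comm (truncation S (f t))] at h4
  linarith

end Truncation

/-! ### Explicit coordinate functionals when all but finitely many nodes are integers. -/

section Interpolation

variable {τ : ℤ → ℝ}

lemma sinc_pi_mul_sub_int (t : ℝ) (j : ℤ) (h : t ≠ j) :
    Real.sinc (Real.pi * (t - j)) = (-1) ^ j * Real.sin (Real.pi * t) / (Real.pi * (t - j)) := by
  rw [Real.sinc_of_ne_zero (mul_ne_zero Real.pi_ne_zero (sub_ne_zero.2 h)), mul_sub,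
    mul_comm Real.pi (j : ℝ), Real.sin_sub_int_mul_pi]

/-- The coefficient at `j` of the interpolating combination of cardinal sines with zeros at
`τ i`, `i ∈ S \ {k}`. -/
def interpCoeff (τ : ℤ → ℝ) (S : Finset ℤ) (k j : ℤ) : ℂ :=
  (-1) ^ j * (Lagrange.nodalWeight S (fun i : ℤ => (i : ℂ)) j *
    (Lagrange.nodal (S.erase k) fun i : ℤ => (τ i : ℂ)).eval (j : ℂ))

/-- The functional whose values along the exponentials vanish at `τ i`, `i ∈ S \ {k}`, and at the
integers outside `S`. -/
def interpFunctional (τ : ℤ → ℝ) (S : Finset ℤ) (k : ℤ) : L2Circle →L[ℂ] ℂ :=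
  ∑ j ∈ S, interpCoeff τ S k j • innerSL ℂ (expVec j)

lemma interpFunctional_expVec (S : Finset ℤ) (k : ℤ) (t : ℝ) :
    interpFunctional τ S k (expVec t) =
      ∑ j ∈ S, interpCoeff τ S k j * (Real.sinc (Real.pi * (t - j)) : ℂ) := by
  rw [interpFunctional, sum_apply]
  refine Finset.sum_congr rfl fun j _ => ?_
  rw [smul_apply, innerSL_apply_apply, inner_expVec, smul_eq_mul]

lemma interpFunctional_int (S : Finset ℤ) (k m : ℤ) :
    interpFunctional τ S k (expVec m) = if m ∈ S then interpCoeff τ S k m else 0 := by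
  rw [interpFunctional_expVec]
  have h : ∀ j ∈ S, interpCoeff τ S k j * (Real.sinc (Real.pi * ((m : ℝ) - j)) : ℂ) =
      if j = m then interpCoeff τ S k m else 0 := by
    intro j _
    rw [← Int.cast_sub, sinc_pi_mul_int]
    split_ifs with h1 h2 h2
    · subst h2; simp
    · exact absurd (sub_eq_zero.1 h1).symm h2
    · subst h2; simp at h1
    · simp
  rw [Finset.sum_congr rfl h, Finset.sum_ite_eq']

/-- Since `sinc(π(t - j)) = (-1)^j sin πt / (π(t - j))`, the combination is `sin πt / π` times the
barycentric Lagrange sum of the nodal polynomial `P` at the integers of `S`. The interpolation is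
exact because `deg P = |S| - 1`. -/
lemma interpFunctional_mul_prod {S : Finset ℤ} {k : ℤ} (hk : k ∈ S) {t : ℝ}
    (ht : ∀ m : ℤ, t ≠ m) :
    interpFunctional τ S k (expVec t) * ∏ j ∈ S, ((t : ℂ) - (j : ℂ)) =
      (Real.sin (Real.pi * t) : ℂ) / Real.pi * ∏ j ∈ S.erase k, ((t : ℂ) - (τ j : ℂ)) := by
  set v : ℤ → ℂ := fun i => (i : ℂ) with hv
  set P := Lagrange.nodal (S.erase k) fun i : ℤ => (τ i : ℂ) with hP
  have hinj : Set.InjOn v S := fun i _ j _ h => by simpa [hv] using h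
  have hdeg : P.degree < S.card := by
    rw [hP, Lagrange.degree_nodal, Finset.card_erase_of_mem hk]
    have := Finset.card_pos.2 ⟨k, hk⟩
    exact_mod_cast Nat.sub_lt this one_pos
  have htc : ∀ i ∈ S, (t : ℂ) ≠ v i := fun i _ h => ht i (by simp only [hv] at h; exact_mod_cast h)
  have h1 := Lagrange.eq_interpolate hinj hdeg
  have h2 := Lagrange.eval_interpolate_not_at_node (fun i => P.eval (v i)) htc
  have hQ : (Lagrange.nodal S v).eval (t : ℂ) = ∏ j ∈ S, ((t : ℂ) - (j : ℂ)) := Lagrange.eval_nodal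
  rw [← h1, hQ] at h2
  have h3 : P.eval (t : ℂ) = ∏ j ∈ S.erase k, ((t : ℂ) - (τ j : ℂ)) := Lagrange.eval_nodal
  rw [← h3, h2, interpFunctional_expVec, Finset.sum_mul, Finset.mul_sum, Finset.mul_sum]
  refine Finset.sum_congr rfl fun j hj => ?_
  have hj' : (t : ℂ) - (j : ℂ) ≠ 0 := sub_ne_zero.2 (htc j hj)
  have hpi : (Real.pi : ℂ) ≠ 0 := by exact_mod_cast Real.pi_ne_zero
  have hs : ((-1 : ℂ) ^ j) * (-1) ^ j = 1 := by
    rw [← mul_zpow]; simp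
  rw [sinc_pi_mul_sub_int t j (ht j), interpCoeff]
  push_cast
  simp only [hv, ← hP]
  field_simp
  linear_combination (Lagrange.nodalWeight S (fun i : ℤ => (i : ℂ)) j * P.eval (j : ℂ) *
    Complex.sin (Real.pi * t) * ∏ j ∈ S, ((t : ℂ) - (j : ℂ))) * hs

lemma interpFunctional_node (hτ : ∀ k : ℤ, |τ k - (k : ℝ)| ≤ 1 / 4) {S : Finset ℤ} {k j : ℤ}
    (hk : k ∈ S) (hj : j ∈ S) (hjk : j ≠ k) : interpFunctional τ S k (expVec (τ j)) = 0 := by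
  by_cases ht : ∀ m : ℤ, τ j ≠ m
  · have h := interpFunctional_mul_prod (τ := τ) hk ht
    have h0 : ∏ i ∈ S.erase k, ((τ j : ℂ) - (τ i : ℂ)) = 0 :=
      Finset.prod_eq_zero (Finset.mem_erase.2 ⟨hjk, hj⟩) (sub_self _)
    rw [h0, mul_zero] at h
    refine (mul_eq_zero.1 h).resolve_right (Finset.prod_ne_zero_iff.2 fun i _ h1 => ht i ?_)
    exact_mod_cast sub_eq_zero.1 h1
  -- The product formula is unavailable at an integer. An integer node `t_j` must equal `j`, where
  -- the coefficient itself vanishes.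
  · push Not at ht
    obtain ⟨m, hm⟩ := ht
    have hmj : m = j := by
      have h1 := hτ j
      rw [hm, ← Int.cast_sub, ← Int.cast_abs] at h1
      have h2 : |m - j| < 1 := by
        have : ((|m - j| : ℤ) : ℝ) < 1 := by linarith
        exact_mod_cast this
      exact sub_eq_zero.1 (Int.abs_lt_one_iff.1 h2)
    subst hmj
    rw [hm, interpFunctional_int, if_pos hj, interpCoeff, Lagrange.eval_nodal,
      Finset.prod_eq_zero (Finset.mem_erase.2 ⟨hjk, hj⟩), mul_zero, mul_zero]
    rw [hm]
    simp

/-- Both products, over the nodes and over the integers, are put in canonical form. The integer one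
becomes a partial Euler product for the sine, so the bracket tends to `G(t)`. -/
lemma interpFunctional_mul_sub (hτ : ∀ k : ℤ, |τ k - (k : ℝ)| ≤ 1 / 4) (k : ℤ) (N : ℕ)
    (hk : k ∈ Finset.Icc (-(N : ℤ)) N) :
    ∃ ν : ℂ, ν ≠ 0 ∧ ∀ t : ℝ, (∀ m : ℤ, t ≠ m) →
      interpFunctional τ (Finset.Icc (-(N : ℤ)) N) k (expVec t) * ((t : ℂ) - τ k) =
        ν * (Complex.sin (Real.pi * t) /
          (Real.pi * t * ∏ j ∈ Finset.range N, ((1 : ℂ) - (t : ℂ) ^ 2 / ((j : ℂ) + 1) ^ 2)) *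
          (((t : ℂ) - τ 0) * ∏ j ∈ Finset.range N, pairFactor τ (j + 1) t)) := by
  obtain ⟨ν, hν, h1⟩ := prod_Icc_sub_eq hτ N
  obtain ⟨ν', hν', h2⟩ := prod_Icc_sub_eq (τ := fun k : ℤ => (k : ℝ)) (fun k => by simp) N
  refine ⟨ν / ν', div_ne_zero hν hν', fun t ht => ?_⟩
  have h3 := interpFunctional_mul_prod (τ := τ) hk ht
  have h4 := h1 t
  rw [← Finset.mul_prod_erase _ _ hk] at h4
  have h5 := h2 t
  have h6 : ∀ j : ℕ, pairFactor (fun k : ℤ => (k : ℝ)) (j + 1) t =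
      (1 : ℂ) - (t : ℂ) ^ 2 / ((j : ℂ) + 1) ^ 2 := by
    intro j
    have : (j : ℂ) + 1 ≠ 0 := by exact_mod_cast Nat.succ_ne_zero j
    rw [pairFactor]
    push_cast
    rw [div_neg]
    field_simp
    ring
  simp_rw [h6] at h5
  simp only [Int.cast_zero, Complex.ofReal_zero, sub_zero, Complex.ofReal_intCast] at h5
  have h7 : ∏ j ∈ Finset.Icc (-(N : ℤ)) N, ((t : ℂ) - (j : ℂ)) ≠ 0 :=
    Finset.prod_ne_zero_iff.2 fun i _ h1 => ht i (by exact_mod_cast sub_eq_zero.1 h1)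
  have h8 : (t : ℂ) * ∏ j ∈ Finset.range N, ((1 : ℂ) - (t : ℂ) ^ 2 / ((j : ℂ) + 1) ^ 2) ≠ 0 := by
    intro h; rw [h, mul_zero] at h5; exact h7 h5
  have hpi : (Real.pi : ℂ) ≠ 0 := by exact_mod_cast Real.pi_ne_zero
  refine mul_right_cancel₀ h7 ?_
  rw [mul_right_comm, h3, mul_assoc _ _ ((t : ℂ) - τ k), mul_comm _ ((t : ℂ) - τ k), h4, h5,
    Complex.ofReal_sin, Complex.ofReal_mul, mul_assoc (Real.pi : ℂ)]
  generalize (t : ℂ) * ∏ j ∈ Finset.range N, ((1 : ℂ) - (t : ℂ) ^ 2 / ((j : ℂ) + 1) ^ 2) = Q at h8 ⊢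
  field_simp

end Interpolation

/-! ### Coordinates in the Riesz basis as sampling functions. -/

section Sampling

variable {τ : ℤ → ℝ}

lemma ext_of_single {F : Type*} [NormedAddCommGroup F] [NormedSpace ℂ F] {A B : L2Z →L[ℂ] F}
    (h : ∀ k, A (lp.single 2 k 1) = B (lp.single 2 k 1)) : A = B := by
  refine ContinuousLinearMap.ext fun x => ?_
  have hA := (lp.hasSum_single (p := 2) (by simp) x).mapL A
  have hB := (lp.hasSum_single (p := 2) (by simp) x).mapL B
  refine hA.unique ?_
  convert! hB using 2 with k
  have e : lp.single 2 k (x k) = x k • (lp.single 2 k (1 : ℂ) : L2Z) := by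
    rw [← lp.single_smul]; simp
  rw [e, map_smul, map_smul, h]

/-- Replacing the nodes outside a finite set by the integers. -/
def truncatedOp (T : L2Z ≃L[ℂ] L2Circle) (S : Finset ℤ) : L2Z →L[ℂ] L2Circle :=
  synthesis - (synthesis - (T : L2Z →L[ℂ] L2Circle)) ∘L truncation S

lemma norm_synthesis_sub_truncatedOp_apply_le (T : L2Z ≃L[ℂ] L2Circle) (S : Finset ℤ) (x : L2Z) :
    ‖(synthesis - truncatedOp T S) x‖ ≤ ‖synthesis - (T : L2Z →L[ℂ] L2Circle)‖ * ‖x‖ := by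
  have e : (synthesis - truncatedOp T S) x =
      (synthesis - (T : L2Z →L[ℂ] L2Circle)) (truncation S x) := by
    rw [truncatedOp, sub_sub_cancel]
    rfl
  rw [e]
  exact (ContinuousLinearMap.le_opNorm _ _).trans
    (mul_le_mul_of_nonneg_left (norm_truncation_apply_le S x) (norm_nonneg _))

lemma truncatedOp_single {T : L2Z ≃L[ℂ] L2Circle}
    (hT : ∀ k, T (lp.single 2 k 1) = expVec (τ k)) (S : Finset ℤ) (k : ℤ) :
    truncatedOp T S (lp.single 2 k 1) = if k ∈ S then expVec (τ k) else expVec k := by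
  rw [truncatedOp, sub_apply, ContinuousLinearMap.comp_apply, truncation_single, synthesis_single,
    one_smul]
  split_ifs
  · rw [sub_apply, synthesis_single, one_smul, ContinuousLinearEquiv.coe_coe, hT]
    abel
  · rw [map_zero, sub_zero]

lemma exists_truncated_equiv {T : L2Z ≃L[ℂ] L2Circle}
    (hT1 : ‖synthesis - (T : L2Z →L[ℂ] L2Circle)‖ < 1) (S : Finset ℤ) :
    ∃ V : L2Z ≃L[ℂ] L2Circle, ∀ x, V x = truncatedOp T S x :=
  exists_equiv_of_norm_sub_lt_one _ (lt_of_le_of_lt (ContinuousLinearMap.opNorm_le_bound _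
    (norm_nonneg _) (norm_synthesis_sub_truncatedOp_apply_le T S)) hT1)

/-- The operators `V S` are bounded below by `1 - ‖D‖` uniformly in `S`, and `V S` maps the error to
`-D` applied to the tail of `T⁻¹ f`, which tends to `0`. -/
lemma tendsto_truncated_symm {T : L2Z ≃L[ℂ] L2Circle}
    (hT1 : ‖synthesis - (T : L2Z →L[ℂ] L2Circle)‖ < 1) {V : Finset ℤ → (L2Z ≃L[ℂ] L2Circle)}
    (hV : ∀ S x, V S x = truncatedOp T S x) (f : L2Circle) :
    Filter.Tendsto (fun S => (V S).symm f) Filter.atTop (nhds (T.symm f)) := by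
  set D := synthesis - (T : L2Z →L[ℂ] L2Circle) with hD
  have hpos : 0 < 1 - ‖D‖ := by linarith
  have h1 : ∀ S (y : L2Z), (1 - ‖D‖) * ‖y‖ ≤ ‖V S y‖ := by
    intro S y
    have h2 := norm_synthesis_sub_truncatedOp_apply_le T S y
    rw [sub_apply, ← hV, ← hD] at h2
    have h3 := norm_sub_norm_le (synthesis y) (V S y)
    rw [norm_synthesis_apply] at h3
    linarith
  have h4 : ∀ S, V S ((V S).symm f - T.symm f) = -D (T.symm f - truncation S (T.symm f)) := by
    intro S
    have h5 : f = T (T.symm f) := (T.apply_symm_apply f).symm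
    rw [map_sub, ContinuousLinearEquiv.apply_symm_apply, hV, truncatedOp, sub_apply, map_sub,
      ContinuousLinearMap.comp_apply, ← hD]
    nth_rewrite 1 [h5]
    have h6 : D (T.symm f) = synthesis (T.symm f) - T (T.symm f) := rfl
    rw [h6]
    abel
  rw [tendsto_iff_norm_sub_tendsto_zero]
  have h7 : Filter.Tendsto (fun S => (1 - ‖D‖)⁻¹ * ‖D (T.symm f - truncation S (T.symm f))‖)
      Filter.atTop (nhds 0) := by
    have h8 := (tendsto_const_nhds (x := T.symm f)).sub (tendsto_truncation (T.symm f))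
    have h9 := ((D.continuous.tendsto _).comp h8).norm.const_mul (1 - ‖D‖)⁻¹
    simpa using h9
  refine squeeze_zero (fun S => norm_nonneg _) (fun S => ?_) h7
  have h10 := h1 S ((V S).symm f - T.symm f)
  rw [h4, norm_neg] at h10
  rw [← div_eq_inv_mul, le_div_iff₀ hpos, mul_comm]
  exact h10

lemma tendsto_Icc_atTop :
    Filter.Tendsto (fun N : ℕ => Finset.Icc (-(N : ℤ)) N) Filter.atTop Filter.atTop := by
  refine Filter.tendsto_atTop_finset_of_monotone ?_ fun k => ⟨k.natAbs, ?_⟩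
  · intro M N h
    refine Finset.Icc_subset_Icc ?_ ?_ <;> omega
  · rw [Finset.mem_Icc]; omega

lemma sin_pi_mul_ne_zero_of_ne_int {t : ℝ} (ht : ∀ m : ℤ, t ≠ m) :
    Complex.sin (Real.pi * t) ≠ 0 := by
  rw [← Complex.ofReal_mul, ← Complex.ofReal_sin, Complex.ofReal_ne_zero]
  intro h
  obtain ⟨n, hn⟩ := Real.sin_eq_zero_iff.1 h
  refine ht n (mul_left_cancel₀ Real.pi_ne_zero ?_)
  rw [← hn, mul_comm]

/-- Away from the integers, the coordinates of the exponentials are proportional to the quotients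
of the canonical product. -/
lemma G_mul_coord_comm (hτ : ∀ k : ℤ, |τ k - (k : ℝ)| ≤ 1 / 4) {T : L2Z ≃L[ℂ] L2Circle}
    (hT : ∀ k, T (lp.single 2 k 1) = expVec (τ k))
    (hT1 : ‖synthesis - (T : L2Z →L[ℂ] L2Circle)‖ < 1) (k : ℤ) {s t : ℝ} (hs : ∀ m : ℤ, s ≠ m)
    (ht : ∀ m : ℤ, t ≠ m) :
    G τ t * (((s : ℂ) - τ k) * T.symm (expVec s) k) =
      G τ s * (((t : ℂ) - τ k) * T.symm (expVec t) k) := by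
  choose V hV using exists_truncated_equiv hT1
  set I : ℕ → Finset ℤ := fun N => Finset.Icc (-(N : ℤ)) N with hI
  have hcoord : ∀ r : ℝ, Filter.Tendsto (fun N => (V (I N)).symm (expVec r) k) Filter.atTop
      (nhds (T.symm (expVec r) k)) := fun r =>
    (((lp.evalCLM ℂ (fun _ : ℤ => ℂ) 2 k).continuous.tendsto _).comp
      (tendsto_truncated_symm hT1 hV (expVec r))).comp tendsto_Icc_atTop
  set g : ℕ → ℝ → ℂ := fun N r => Complex.sin (Real.pi * r) /
    (Real.pi * r * ∏ j ∈ Finset.range N, ((1 : ℂ) - (r : ℂ) ^ 2 / ((j : ℂ) + 1) ^ 2)) *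
    (((r : ℂ) - τ 0) * ∏ j ∈ Finset.range N, pairFactor τ (j + 1) r) with hg
  have hgG : ∀ r : ℝ, (∀ m : ℤ, r ≠ m) →
      Filter.Tendsto (fun N => g N r) Filter.atTop (nhds (G τ r)) := by
    intro r hr
    have h0 := sin_pi_mul_ne_zero_of_ne_int hr
    have h1 := ((tendsto_const_nhds (x := Complex.sin (Real.pi * r))).div
      (Complex.tendsto_euler_sin_prod r) h0).mul (tendsto_G hτ r)
    rw [div_self h0, one_mul] at h1
    exact h1
  -- Comparing two points `s` and `t` eliminates the constants depending on `N`, whose limits are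
  -- never needed.
  have hN : ∀ᶠ N in Filter.atTop, g N t * (((s : ℂ) - τ k) * (V (I N)).symm (expVec s) k) =
      g N s * (((t : ℂ) - τ k) * (V (I N)).symm (expVec t) k) := by
    filter_upwards [Filter.eventually_ge_atTop k.natAbs] with N hkN
    have hk : k ∈ I N := by rw [hI, Finset.mem_Icc]; omega
    obtain ⟨ν, hν, h1⟩ := interpFunctional_mul_sub hτ k N hk
    set φ := interpFunctional τ (I N) k with hφ
    -- The functional kills every vector of the truncated basis except the `k`-th, so it is a
    -- multiple of the `k`-th coordinate.
    have h2 : φ ∘L (V (I N) : L2Z →L[ℂ] L2Circle) =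
        φ (expVec (τ k)) • lp.evalCLM ℂ (fun _ : ℤ => ℂ) 2 k := by
      refine ext_of_single fun j => ?_
      rw [ContinuousLinearMap.comp_apply, ContinuousLinearEquiv.coe_coe, hV, truncatedOp_single hT,
        smul_apply, smul_eq_mul]
      change _ = _ * (lp.single 2 j (1 : ℂ) : L2Z) k
      rcases eq_or_ne j k with rfl | hjk
      · rw [if_pos hk, lp.single_apply_self, mul_one]
      · rw [lp.single_apply_ne _ _ _ hjk.symm, mul_zero]
        split_ifs with hj
        · exact interpFunctional_node hτ hk hj hjk
        · rw [hφ, interpFunctional_int, if_neg hj]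
    have h3 : ∀ r, φ (expVec r) = φ (expVec (τ k)) * (V (I N)).symm (expVec r) k := by
      intro r
      have h4 := congrArg (fun A => A ((V (I N)).symm (expVec r))) h2
      have h5 : (lp.evalCLM ℂ (fun _ : ℤ => ℂ) 2 k) ((V (I N)).symm (expVec r)) =
          (V (I N)).symm (expVec r) k := rfl
      simpa [h5] using h4
    have ht1 := h1 t ht
    have hs1 := h1 s hs
    rw [h3] at ht1 hs1
    refine mul_left_cancel₀ hν ?_
    change _ = ν * g N t at ht1
    change _ = ν * g N s at hs1
    linear_combination (-(((s : ℂ) - τ k) * (V (I N)).symm (expVec s) k)) * ht1 +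
      (((t : ℂ) - τ k) * (V (I N)).symm (expVec t) k) * hs1
  have hl := (hgG t ht).mul ((hcoord s).const_mul ((s : ℂ) - τ k))
  have hr := (hgG s hs).mul ((hcoord t).const_mul ((t : ℂ) - τ k))
  exact tendsto_nhds_unique_of_eventuallyEq hl hr hN

lemma continuous_coord (T : L2Z ≃L[ℂ] L2Circle) (k : ℤ) :
    Continuous fun t : ℝ => T.symm (expVec t) k :=
  (lp.evalCLM ℂ (fun _ : ℤ => ℂ) 2 k).continuous.comp
    (T.symm.continuous.comp continuous_expVec)

lemma half_ne_int (m : ℤ) : (1 / 2 : ℝ) ≠ m := by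
  intro h
  have h1 : (1 : ℝ) = ((2 * m : ℤ) : ℝ) := by push_cast; linarith
  have h2 : (1 : ℤ) = 2 * m := by exact_mod_cast h1
  omega

lemma G_half_ne_zero (hτ : ∀ k : ℤ, |τ k - (k : ℝ)| ≤ 1 / 4) : G τ ((1 / 2 : ℝ) : ℂ) ≠ 0 := by
  rw [Ne, G_eq_zero_iff hτ]
  rintro ⟨k, hk⟩
  have hk' : (1 / 2 : ℝ) = τ k := by exact_mod_cast hk
  have h1 := abs_le.1 (hτ k)
  rw [← hk'] at h1
  have h2 : (0 : ℝ) < k := by linarith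
  have h3 : (k : ℝ) < 1 := by linarith
  have h4 : 0 < k := by exact_mod_cast h2
  have h5 : k < 1 := by exact_mod_cast h3
  omega

/-- The reference point `1/2` is neither an integer nor a zero of `G`; continuity and density of the
non-integers extend the relation to all real `t`. -/
lemma exists_coord_eq (hτ : ∀ k : ℤ, |τ k - (k : ℝ)| ≤ 1 / 4) {T : L2Z ≃L[ℂ] L2Circle}
    (hT : ∀ k, T (lp.single 2 k 1) = expVec (τ k))
    (hT1 : ‖synthesis - (T : L2Z →L[ℂ] L2Circle)‖ < 1) (k : ℤ) :
    ∃ κ : ℂ, ∀ t : ℝ, ((t : ℂ) - τ k) * T.symm (expVec t) k = κ * G τ t := by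
  have h0 := G_half_ne_zero hτ
  set s : ℝ := 1 / 2 with hs
  refine ⟨((s : ℂ) - τ k) * T.symm (expVec s) k / G τ s, fun t => ?_⟩
  have hGc : Continuous fun t : ℝ => G τ t :=
    (differentiable_G hτ).continuous.comp Complex.continuous_ofReal
  have hKc := continuous_coord T k
  have hdense : Dense {t : ℝ | ∀ m : ℤ, t ≠ m} := by
    have h1 : (Set.range ((↑) : ℤ → ℝ)).Countable := Set.countable_range _
    have h2 : Dense (Set.range ((↑) : ℤ → ℝ))ᶜ := h1.dense_compl ℝ
    refine h2.mono ?_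
    intro t ht m h
    exact ht ⟨m, h.symm⟩
  have h2 : (fun t : ℝ => G τ t * (((s : ℂ) - τ k) * T.symm (expVec s) k)) =
      fun t : ℝ => G τ s * (((t : ℂ) - τ k) * T.symm (expVec t) k) := by
    refine Continuous.ext_on hdense (by fun_prop) (by fun_prop) fun t ht => ?_
    exact G_mul_coord_comm hτ hT hT1 k half_ne_int ht
  have h3 := congrFun h2 t
  simp only at h3
  field_simp
  linear_combination -h3

lemma coord_node {T : L2Z ≃L[ℂ] L2Circle} (hT : ∀ k, T (lp.single 2 k 1) = expVec (τ k)) (k : ℤ) :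
    T.symm (expVec (τ k)) k = 1 := by
  rw [← hT, ContinuousLinearEquiv.symm_apply_apply, lp.single_apply_self]

/-- The zeros of the canonical product are simple, and the coordinates of the exponentials in the
Riesz basis of nodes are the sampling functions. -/
lemma deriv_G_ne_zero_and_coord_eq (hτ : ∀ k : ℤ, |τ k - (k : ℝ)| ≤ 1 / 4)
    {T : L2Z ≃L[ℂ] L2Circle} (hT : ∀ k, T (lp.single 2 k 1) = expVec (τ k))
    (hT1 : ‖synthesis - (T : L2Z →L[ℂ] L2Circle)‖ < 1) (k : ℤ) :
    deriv (G τ) (τ k) ≠ 0 ∧ ∀ t : ℝ, T.symm (expVec t) k = samplingKernel τ k t := by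
  obtain ⟨κ, hκ⟩ := exists_coord_eq hτ hT hT1 k
  have h1 : HasDerivAt (fun t : ℝ => κ * G τ t) (κ * deriv (G τ) (τ k)) (τ k) :=
    ((differentiable_G hτ (τ k)).hasDerivAt.comp_ofReal).const_mul κ
  -- The difference quotient of `(t - t_k)(T⁻¹ e_t)_k` at `t_k` is the coordinate itself, which
  -- tends to `1`. Hence `κ G'(t_k) = 1`.
  have h2 : HasDerivAt (fun t : ℝ => κ * G τ t) 1 (τ k) := by
    rw [hasDerivAt_iff_tendsto_slope]
    have h3 : Filter.Tendsto (fun t : ℝ => T.symm (expVec t) k) (nhdsWithin (τ k) {τ k}ᶜ)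
        (nhds 1) := by
      rw [← coord_node hT k]
      exact ((continuous_coord T k).tendsto _).mono_left nhdsWithin_le_nhds
    refine h3.congr' ?_
    filter_upwards [self_mem_nhdsWithin] with t ht
    have ht' : (t : ℂ) - τ k ≠ 0 := by
      rw [sub_ne_zero]; exact_mod_cast ht
    rw [slope_def_module, ← hκ, ← hκ, sub_self, zero_mul, sub_zero, Complex.real_smul]
    push_cast
    field_simp
  have h4 := h1.unique h2
  have h5 : deriv (G τ) (τ k) ≠ 0 := fun h => by simp [h] at h4
  refine ⟨h5, fun t => ?_⟩
  rw [samplingKernel]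
  split_ifs with ht
  · rw [ht, coord_node hT k]
  · have ht' : (t : ℂ) - τ k ≠ 0 := by
      rw [sub_ne_zero]; exact_mod_cast ht
    rw [eq_div_iff (mul_ne_zero h5 ht')]
    linear_combination (deriv (G τ) (τ k)) * hκ t + G τ t * h4

/-- The exponentials with nodes `τ k` form a Riesz basis. -/
lemma exists_riesz_equiv {L : ℝ} (hL : L < 1 / 4) (hτ : ∀ k : ℤ, |τ k - (k : ℝ)| ≤ L) :
    ∃ T : L2Z ≃L[ℂ] L2Circle, (∀ k, T (lp.single 2 k 1) = expVec (τ k)) ∧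
      ‖synthesis - (T : L2Z →L[ℂ] L2Circle)‖ < 1 := by
  obtain ⟨B, hB, hBs⟩ := exists_kadec_perturbation τ hL hτ
  obtain ⟨T, hT⟩ := exists_equiv_of_norm_sub_lt_one (synthesis - B) (by rwa [sub_sub_cancel])
  have hT' : (T : L2Z →L[ℂ] L2Circle) = synthesis - B := ContinuousLinearMap.ext hT
  refine ⟨T, fun k => ?_, by rwa [hT', sub_sub_cancel]⟩
  rw [hT, sub_apply, hBs, synthesis_single, one_smul, sub_sub_cancel]

end Sampling

end DiscreteHilbert

end

theorem theorem4p2 (a aStar : DiscreteHilbert.L2Z) (τ : ℤ → ℝ)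
    (hτ : ∃ L : ℝ, L < 1 / 4 ∧ ∀ k : ℤ, |τ k - (k : ℝ)| ≤ L) :
    -- the canonical product converges to an entire function with simple zeros at the `t_k`
    ((∀ z : ℂ, Multipliable fun k : ℕ => DiscreteHilbert.pairFactor τ (k + 1) z) ∧
      Differentiable ℂ (DiscreteHilbert.G τ) ∧
      (∀ z : ℂ, DiscreteHilbert.G τ z = 0 ↔ ∃ k : ℤ, z = (τ k : ℂ)) ∧
      ∀ k : ℤ, deriv (DiscreteHilbert.G τ) (τ k : ℂ) ≠ 0) ∧
    -- the sampling series converges to `Ψ`, uniformly on every compact subset of the line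
    ∀ K : Set ℝ, IsCompact K →
      TendstoUniformlyOn
        (fun (s : Finset ℤ) (t : ℝ) =>
          ∑ k ∈ s, DiscreteHilbert.Psi a aStar (τ k) * DiscreteHilbert.samplingKernel τ k t)
        (DiscreteHilbert.Psi a aStar) Filter.atTop K := by
  obtain ⟨L, hL, hτL⟩ := hτ
  have hτ4 : ∀ k : ℤ, |τ k - (k : ℝ)| ≤ 1 / 4 := fun k => (hτL k).trans hL.le
  obtain ⟨T, hT, hT1⟩ := DiscreteHilbert.exists_riesz_equiv hL hτL
  have hG := DiscreteHilbert.deriv_G_ne_zero_and_coord_eq hτ4 hT hT1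
  refine ⟨⟨DiscreteHilbert.multipliable_pairFactor hτ4, DiscreteHilbert.differentiable_G hτ4,
    DiscreteHilbert.G_eq_zero_iff hτ4, fun k => (hG k).1⟩, fun K hK => ?_⟩
  obtain ⟨φ, hφ⟩ := DiscreteHilbert.exists_functional_Psi a aStar
  -- This functional on `l²` takes `δ_k` to `Ψ(t_k)` and `T⁻¹ e_t` to `Ψ(t)`, so it carries
  -- truncations to partial sums of the series.
  set A : DiscreteHilbert.L2Z →L[ℂ] ℂ :=
    φ ∘L (T : DiscreteHilbert.L2Z →L[ℂ] DiscreteHilbert.L2Circle) with hA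
  have h1 := A.uniformContinuous.comp_tendstoUniformlyOn
    (DiscreteHilbert.tendstoUniformlyOn_truncation
      (T.symm.continuous.comp DiscreteHilbert.continuous_expVec) hK)
  refine (h1.congr ?_).congr_right ?_
  · refine Filter.Eventually.of_forall fun S t _ => ?_
    simp only [Function.comp_apply]
    rw [DiscreteHilbert.truncation_apply, map_sum]
    refine Finset.sum_congr rfl fun k _ => ?_
    have e : lp.single 2 k (T.symm (DiscreteHilbert.expVec t) k) =
        T.symm (DiscreteHilbert.expVec t) k • (lp.single 2 k (1 : ℂ) : DiscreteHilbert.L2Z) := by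
      rw [← lp.single_smul]; simp
    rw [e, map_smul, (hG k).2 t, hA, ContinuousLinearMap.comp_apply,
      ContinuousLinearEquiv.coe_coe, hT, ← hφ, smul_eq_mul, mul_comm]
  · intro t _
    simp [hA, hφ]
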